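/- Let $n\ge 1$ and $\ell\in\{1,\dots,n\}$, and fix constants $K_\alpha$, one for each multi-index $\alpha\in\mathbb N_0^n$. There is a constant $C>0$, depending only on $n$, $\ell$ and the constants $K_\alpha$, with the following property. Let $\Omega\subset\mathbb R^n$ be a bounded domain that is star shaped with respect to a ball $B\subset\Omega$, i.e. for every $y\in\Omega$ the convex hull of $B\cup\{y\}$ is contained in $\Omega$. Set $R=\operatorname{diam}(\Omega)$, $\rho=\operatorname{diam}(B)$, and write $|\cdot|$ for Lebesgue measure. Let $\theta\in C_0^\infty(\mathbb R^n)$ be supported on $B$ with $$\int\theta\,dx=1,\qquad \|\partial^\alpha\theta\|_{L^1}\le \frac{K_\alpha}{\rho^{|\alpha|}},\qquad \|\partial^\alpha\theta\|_{L^\infty}\le\frac{K_\alpha}{\rho^{n+|\alpha|}}\qquad\text{for all }\alpha .$$ For a differential $\ell$-form $u=\sum_I u_I\,dx_I\in L^2(\Omega,\Lambda^\ell)$, i.e. with all $u_I\in L^2(\Omega)$ (the sum is over increasing $\ell$-tuples $I$), define the Bogovskiĭ-type operator $$\mathtt B_\ell u(x)=\int_\Omega G_\ell(x,y)\,(x-y)\lrcorner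 u(y)\,dy,\qquad G_\ell(x,y)=\int_1^\infty (t-1)^{n-\ell}t^{\ell-1}\theta(y+t(x-y))\,dt,$$ where $z\lrcorner\omega=\omega(z,\cdot,\dots,\cdot)$ denotes contraction. Then, for every $u\in L^2(\Omega,\Lambda^\ell)$, the integral defining $\mathtt B_\ell u(x)$ converges absolutely for almost every $x\in\Omega$, $\mathtt B_\ell u\in H^1(\Omega,\Lambda^{\ell-1})$, and $$|\mathtt B_\ell u|_{H^1(\Omega,\Lambda^{\ell-1})}\le C\,\frac R\rho\,\kappa\,\|u\|_{L^2(\Omega,\Lambda^\ell)},$$ where $\|u\|_{L^2(\Omega,\Lambda^\ell)}^2=\sum_I\|u_I\|_{L^2(\Omega)}^2$, $|v|_{H^1(\Omega,\Lambda^{\ell-1})}^2=\sum_J\sum_{j=1}^n\|\partial_j v_J\|_{L^2(\Omega)}^2$, and $$\kappa=1\quad\text{if }\ell<\tfrac n2+1,\qquad \kappa=1+\Bigl(\log\tfrac{|\Omega|}{|B|}\Bigr)^{\frac{n}{2(\ell-1)}}\Bigl(\tfrac{|\Omega|}{|B|}\Bigr)^{\frac{2(\ell-1)-n}{2(\ell-1)}}\quad\text{if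 }\ell\ge\tfrac n2+1 .$$ -/

import Mathlib

open MeasureTheory Set
open scoped ContDiff

noncomputable section

namespace BogForms

/-- `ℝⁿ` with its Euclidean structure. -/
abbrev E (n : ℕ) : Type := EuclideanSpace ℝ (Fin n)

/-- The `i`-th vector of the canonical basis of `ℝⁿ`. -/
def e {n : ℕ} (i : Fin n) : E n := EuclideanSpace.single i 1

/-- Exterior `ℓ`-forms: alternating `ℓ`-linear functions on `(ℝⁿ)^ℓ`. -/
abbrev Form (n ℓ : ℕ) : Type := E n [⋀^Fin ℓ]→L[ℝ] ℝ

/-- The coefficient `w_I = w(e_{i₁}, …, e_{i_ℓ})` of `dx_I`, for a strictly increasing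
`ℓ`-tuple `I` of indices. -/
def coeff {n ℓ : ℕ} (I : Fin ℓ ↪o Fin n) (w : Form n ℓ) : ℝ := w (fun k => e (I k))

/-- `Ω` contains `B` and contains the convex hull of `B ∪ {y}` for every `y ∈ Ω`. -/
def StarShapedWrt {n : ℕ} (Ω B : Set (E n)) : Prop :=
  B ⊆ Ω ∧ ∀ y ∈ Ω, convexHull ℝ (B ∪ {y}) ⊆ Ω

/-- The partial derivative `∂_{J 0} ⋯ ∂_{J (k-1)} θ (x)` of order `k`; every `∂^α` with `|α| = k`
is of this form. -/
def partialDeriv {n : ℕ} (k : ℕ) (J : Fin k → Fin n) (θ : E n → ℝ) (x : E n) : ℝ :=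
  iteratedFDeriv ℝ k θ x (fun i => e (J i))

/-- `θ` is a smooth function of integral one, supported on the ball `B` of centre `c` and radius
`r`, with `‖∂^α θ‖_{L¹} ≤ K_α / diam(B)^{|α|}` and `‖∂^α θ‖_{L^∞} ≤ K_α / diam(B)^{n + |α|}`
for all multi-indices `α`. -/
structure IsWeight {n : ℕ} (K : (k : ℕ) → (Fin k → Fin n) → ℝ) (c : E n) (r : ℝ)
    (θ : E n → ℝ) : Prop where
  smooth : ContDiff ℝ ∞ θ
  supp : tsupport θ ⊆ Metric.closedBall c r
  integral_eq_one : ∫ x, θ x = 1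
  l1_bound : ∀ (k : ℕ) (J : Fin k → Fin n),
    ∫ x, |partialDeriv k J θ x| ≤ K k J / Metric.diam (Metric.ball c r) ^ k
  sup_bound : ∀ (k : ℕ) (J : Fin k → Fin n) (x : E n),
    |partialDeriv k J θ x| ≤ K k J / Metric.diam (Metric.ball c r) ^ (n + k)

/-- The kernel `G_ℓ(x,y) = ∫_1^∞ (t-1)^{n-ℓ} t^{ℓ-1} θ(y + t(x-y)) dt`, for `1 ≤ ℓ ≤ n`. -/
def kernelG {n : ℕ} (ℓ : ℕ) (θ : E n → ℝ) (x y : E n) : ℝ :=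
  ∫ t in Ioi (1 : ℝ), (t - 1) ^ (n - ℓ) * t ^ (ℓ - 1) * θ (y + t • (x - y))

/-- `G_ℓ(x,y) (x-y) ⌟ u(y)` for an `ℓ`-form `u`, `ℓ = k + 1`. The contraction `z ⌟ w` is
`w(z, ·, …, ·)`. -/
def bogIntegrand {n k : ℕ} (θ : E n → ℝ) (u : E n → Form n (k + 1)) (x y : E n) : Form n k :=
  kernelG (k + 1) θ x y • (u y).curryLeft (x - y)

/-- The Bogovskii-type operator `B_ℓ`, `ℓ = k + 1`, applied to an `ℓ`-form `u` on `Ω`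
(extended by zero outside `Ω`). -/
def bogovskii {n k : ℕ} (θ : E n → ℝ) (Ω : Set (E n)) (u : E n → Form n (k + 1)) (x : E n) :
    Form n k :=
  ∫ y in Ω, bogIntegrand θ u x y

/-- `u ∈ L²(Ω, Λ^ℓ)`: all coefficients belong to `L²(Ω)`. -/
def MemL2 {n ℓ : ℕ} (Ω : Set (E n)) (u : E n → Form n ℓ) : Prop :=
  ∀ I : Fin ℓ ↪o Fin n, MemLp (fun x => coeff I (u x)) 2 (volume.restrict Ω)

/-- `‖u‖_{L²(Ω, Λ^ℓ)}`. -/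
def l2Norm {n ℓ : ℕ} (Ω : Set (E n)) (u : E n → Form n ℓ) : ℝ :=
  √(∑ I : Fin ℓ ↪o Fin n, ∫ x in Ω, coeff I (u x) ^ 2)

/-- `g ∈ L²(Ω)` is the weak partial derivative `∂_j f` on `Ω`. -/
def IsWeakPartial {n : ℕ} (Ω : Set (E n)) (j : Fin n) (f g : E n → ℝ) : Prop :=
  MemLp g 2 (volume.restrict Ω) ∧
    ∀ φ : E n → ℝ, ContDiff ℝ ∞ φ → HasCompactSupport φ → tsupport φ ⊆ Ω →
      ∫ x in Ω, f x * fderiv ℝ φ x (e j) = -∫ x in Ω, g x * φ x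

/-- `f ∈ H¹(Ω)`. -/
def MemH1 {n : ℕ} (Ω : Set (E n)) (f : E n → ℝ) : Prop :=
  MemLp f 2 (volume.restrict Ω) ∧ ∀ j : Fin n, ∃ g, IsWeakPartial Ω j f g

open Classical in
/-- A representative of the weak partial derivative `∂_j f ∈ L²(Ω)` (zero if there is none). -/
def weakPartial {n : ℕ} (Ω : Set (E n)) (j : Fin n) (f : E n → ℝ) : E n → ℝ :=
  if h : ∃ g, IsWeakPartial Ω j f g then h.choose else 0

/-- `v ∈ H¹(Ω, Λ^k)`: all coefficients belong to `H¹(Ω)`. -/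
def FormMemH1 {n k : ℕ} (Ω : Set (E n)) (v : E n → Form n k) : Prop :=
  ∀ I : Fin k ↪o Fin n, MemH1 Ω (fun x => coeff I (v x))

/-- `|v|_{H¹(Ω, Λ^k)}`, for `v ∈ H¹(Ω, Λ^k)`. -/
def h1Seminorm {n k : ℕ} (Ω : Set (E n)) (v : E n → Form n k) : ℝ :=
  √(∑ I : Fin k ↪o Fin n, ∑ j : Fin n,
    ∫ x in Ω, weakPartial Ω j (fun z => coeff I (v z)) x ^ 2)

open Classical in
/-- The factor `κ`, as a function of `n`, `ℓ` and the ratio `q = |Ω| / |B|`. -/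
def kappa (n ℓ : ℕ) (q : ℝ) : ℝ :=
  if (ℓ : ℝ) < (n : ℝ) / 2 + 1 then 1
  else 1 + (Real.log q) ^ ((n : ℝ) / (2 * ((ℓ : ℝ) - 1))) *
    q ^ ((2 * ((ℓ : ℝ) - 1) - (n : ℝ)) / (2 * ((ℓ : ℝ) - 1)))

end BogForms

end

/-!
Extend the components `g = u_{(i, I)}` by zero and test a coefficient of `B_ℓ u` against
`D = ∂_j φ`. Writing `x - y = t⁻¹ ((y + t (x - y) - c) - (y - c))` absorbs the factor `x - y` of the
kernel, at the cost of a factor of the size of `R / ρ`, into `θ` and `g`; what remains is a weighted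
integral over `t > 1` of the trilinear forms `∬ η(y + t (x - y)) D(x) g(y) dx dy`.

For `t > 2` Plancherel turns the form into an integral over frequencies `ξ`; the decay of the
Fourier transform of `η` makes its weight integrable in `t` uniformly in `ξ`, derivative included.
For `1 < t ≤ 2` the derivative is moved onto `η`, and Schur's test bounds the form by
`√(min (t - 1)⁻ⁿ Q)`, where `Q` is comparable to `|Ω| / |B|`: one of the two marginals of
`|∇η|(y + t (x - y))` is bounded, while the marginal in `y ∈ Ω` is at most both `(t - 1)⁻ⁿ` and `Q`.
With `τ = t - 1` this leaves `∫₀¹ τ^(n - ℓ) √(min τ⁻ⁿ Q) dτ`, which is the origin of `κ`.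

Hence `|∫ f ∂_j φ| ≤ M ‖φ‖_{L²}` for every coefficient `f` of `B_ℓ u`, and Riesz representation
yields the weak derivative `∂_j f` together with its bound. That `f` exists almost everywhere and
lies in `L²` follows from Young's inequality, since the kernel is dominated by an integrable
function of `x - y`.
-/

noncomputable section

namespace BogForms

section Plancherel

open scoped FourierTransform ENNReal
open SchwartzMap

variable {V : Type*} [NormedAddCommGroup V] [InnerProductSpace ℝ V] [FiniteDimensional ℝ V]
  [MeasurableSpace V] [BorelSpace V] {f g : V → ℂ}

theorem continuous_fourier (hf : Integrable f) : Continuous (𝓕 f) :=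
  VectorFourier.fourierIntegral_continuous Real.continuous_fourierChar
    (by exact continuous_inner) hf

theorem norm_fourier_le_integral_norm (f : V → ℂ) (ξ : V) : ‖𝓕 f ξ‖ ≤ ∫ x, ‖f x‖ :=
  VectorFourier.norm_fourierIntegral_le_integral_norm _ _ _ _ _

theorem integral_fourier_mul_eq (hf : Integrable f) (hg : Integrable g) :
    ∫ x, 𝓕 f x * g x = ∫ x, f x * 𝓕 g x := by
  simpa using! VectorFourier.integral_fourierIntegral_smul_eq_flip (L := innerₗ V)
    Real.continuous_fourierChar (by exact continuous_inner) hf hg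

theorem fourier_toLp_ae_eq (hf : Integrable f) (hf2 : MemLp f 2) :
    (𝓕 (hf2.toLp f) : Lp ℂ 2 (volume : Measure V)) =ᵐ[volume] 𝓕 f := by
  refine ae_eq_of_integral_contDiff_smul_eq ((Lp.memLp _).locallyIntegrable (by norm_num))
    (continuous_fourier hf).locallyIntegrable fun ψ hψ hψc => ?_
  let Ψ : 𝓢(V, ℂ) := (hψc.comp_left (g := Complex.ofReal) rfl).toSchwartzMap
    (Complex.ofRealCLM.contDiff.comp hψ)
  have hΨ : ∀ x, Ψ x = (ψ x : ℂ) := fun x => rfl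
  have distributional : ∫ x, 𝓕 Ψ x • hf2.toLp f x = ∫ x, Ψ x • 𝓕 (hf2.toLp f) x := by
    have h := congrArg (· Ψ) (Lp.fourier_toTemperedDistribution_eq (hf2.toLp f))
    simpa only [TemperedDistribution.fourier_apply, Lp.toTemperedDistribution_apply] using h
  have classical : ∫ x, 𝓕 Ψ x • hf2.toLp f x = ∫ x, Ψ x • 𝓕 f x := by
    simp only [smul_eq_mul]
    rw [← integral_fourier_mul_eq Ψ.integrable hf]
    refine integral_congr_ae ?_
    filter_upwards [hf2.coeFn_toLp] with x hx
    rw [hx, fourier_coe]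
  simpa [hΨ, Complex.real_smul] using distributional.symm.trans classical

theorem eLpNorm_fourier_eq (hf : Integrable f) (hf2 : MemLp f 2) :
    eLpNorm (𝓕 f) 2 volume = eLpNorm f 2 volume := by
  rw [← eLpNorm_congr_ae (fourier_toLp_ae_eq hf hf2), ← eLpNorm_congr_ae hf2.coeFn_toLp,
    ← Lp.enorm_def, ← Lp.enorm_def, ← ofReal_norm, ← ofReal_norm, Lp.norm_fourier_eq]

theorem eLpNorm_fourierInv_schwartzMap_eq (Φ : 𝓢(V, ℂ)) :
    eLpNorm (𝓕⁻ Φ : 𝓢(V, ℂ)) 2 volume = eLpNorm Φ 2 volume := by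
  rw [← eLpNorm_fourier_eq (𝓕⁻ Φ : 𝓢(V, ℂ)).integrable ((𝓕⁻ Φ : 𝓢(V, ℂ)).memLp 2),
    ← fourier_coe, FourierTransform.fourier_fourierInv_eq]

end Plancherel

section Lintegral

open scoped ENNReal

theorem eLpNorm_two_sq {α F : Type*} [MeasurableSpace α] [ENorm F] (μ : Measure α) (f : α → F) :
    eLpNorm f 2 μ ^ 2 = ∫⁻ x, ‖f x‖ₑ ^ 2 ∂μ := by
  simpa only [NNReal.coe_ofNat, ENNReal.coe_ofNat, ENNReal.rpow_ofNat] using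
    eLpNorm_nnreal_pow_eq_lintegral (μ := μ) (f := f) (p := 2) (by norm_num)

theorem sq_lintegral_mul_mul_le {α : Type*} [MeasurableSpace α] {μ : Measure α}
    {k f g : α → ℝ≥0∞} (hk : AEMeasurable k μ) (hf : AEMeasurable f μ) (hg : AEMeasurable g μ) :
    (∫⁻ x, k x * (f x * g x) ∂μ) ^ 2 ≤ (∫⁻ x, k x * f x ^ 2 ∂μ) * ∫⁻ x, k x * g x ^ 2 ∂μ := by
  have sqrt_sq (a : ℝ≥0∞) : (a ^ (1 / 2 : ℝ)) ^ 2 = a := by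
    rw [← ENNReal.rpow_natCast, ← ENNReal.rpow_mul]
    norm_num
  have sq_sqrt (a : ℝ≥0∞) : (a ^ 2) ^ (1 / 2 : ℝ) = a := by
    rw [← ENNReal.rpow_natCast, ← ENNReal.rpow_mul]
    norm_num
  have split (a b c : ℝ≥0∞) :
      (a * b ^ 2) ^ (1 / 2 : ℝ) * (a * c ^ 2) ^ (1 / 2 : ℝ) = a * (b * c) := by
    rw [← ENNReal.mul_rpow_of_nonneg _ _ (by norm_num),
      show a * b ^ 2 * (a * c ^ 2) = (a * (b * c)) ^ 2 by ring, sq_sqrt]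
  have holder := ENNReal.lintegral_mul_norm_pow_le (μ := μ) (hk.mul (hf.pow_const 2))
    (hk.mul (hg.pow_const 2)) (p := 1 / 2) (q := 1 / 2) (by norm_num) (by norm_num) (by norm_num)
  simp only [Pi.mul_apply, split] at holder
  calc (∫⁻ x, k x * (f x * g x) ∂μ) ^ 2
      ≤ ((∫⁻ x, k x * f x ^ 2 ∂μ) ^ (1 / 2 : ℝ) * (∫⁻ x, k x * g x ^ 2 ∂μ) ^ (1 / 2 : ℝ)) ^ 2 := by
        gcongr
    _ = _ := by rw [mul_pow, sqrt_sq, sqrt_sq]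

variable {V : Type*} [NormedAddCommGroup V] [NormedSpace ℝ V] [FiniteDimensional ℝ V]
  [MeasurableSpace V] [BorelSpace V] (μ : Measure V) [μ.IsAddHaarMeasure]

theorem lintegral_comp_smul (f : V → ℝ≥0∞) {r : ℝ} (hr : r ≠ 0) :
    ∫⁻ x, f (r • x) ∂μ = ENNReal.ofReal |(r ^ Module.finrank ℝ V)⁻¹| * ∫⁻ x, f x ∂μ := by
  have h := (Homeomorph.smulOfNeZero r hr).measurableEmbedding.lintegral_map (μ := μ) f
  simp only [Homeomorph.smulOfNeZero_apply] at h
  rw [← h, Measure.map_addHaar_smul μ hr, lintegral_smul_measure, smul_eq_mul]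

theorem lintegral_dilate_left (f : V → ℝ≥0∞) {t : ℝ} (ht : 0 < t) (y : V) :
    ∫⁻ x, f (y + t • (x - y)) ∂μ = ENNReal.ofReal (t ^ Module.finrank ℝ V)⁻¹ * ∫⁻ x, f x ∂μ := by
  rw [lintegral_sub_right_eq_self (fun x => f (y + t • x)) y,
    lintegral_comp_smul μ (fun x => f (y + x)) ht.ne', lintegral_add_left_eq_self,
    abs_of_pos (by positivity)]

theorem lintegral_dilate_right (f : V → ℝ≥0∞) {t : ℝ} (ht : 1 < t) (x : V) :
    ∫⁻ y, f (y + t • (x - y)) ∂μ =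
      ENNReal.ofReal ((t - 1) ^ Module.finrank ℝ V)⁻¹ * ∫⁻ y, f y ∂μ := by
  have regroup (y : V) : y + t • (x - y) = (1 - t) • y + t • x := by module
  simp_rw [regroup]
  rw [lintegral_comp_smul μ (fun y => f (y + t • x)) (by linarith : 1 - t ≠ 0),
    lintegral_add_right_eq_self, abs_inv, abs_pow, abs_sub_comm, abs_of_pos (by linarith)]

end Lintegral

section Pairing

open scoped FourierTransform ENNReal

variable {V : Type*} [NormedAddCommGroup V] [InnerProductSpace ℝ V] [FiniteDimensional ℝ V]
  [MeasurableSpace V] [BorelSpace V]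

local notation "d" => Module.finrank ℝ V

/-- The trilinear form `∬ η (y + t (x - y)) D x g y dx dy`, in which `η` plays the role of a bump
function, `D` that of a derivative of a test function and `g` that of the datum. The operator
`B_ℓ`, tested against `D`, is a weighted integral of such forms over `t > 1`. -/
def pairing (t : ℝ) (η g D : V → ℝ) : ℝ :=
  ∫ p : V × V, η (p.2 + t • (p.1 - p.2)) * (D p.1 * g p.2)

theorem integrable_pairing {t C : ℝ} {η g D : V → ℝ} (hη : Continuous η) (hηC : ∀ x, ‖η x‖ ≤ C)
    (hg : Integrable g) (hD : Integrable D) :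
    Integrable fun p : V × V => η (p.2 + t • (p.1 - p.2)) * (D p.1 * g p.2) :=
  (hD.mul_prod hg).bdd_mul (c := C) (by fun_prop) (.of_forall fun _ => hηC _)

theorem integrable_comp_dilate {η : V → ℂ} (hη : Integrable η) {t : ℝ} (ht : t ≠ 0) (y : V) :
    Integrable fun x => η (y + t • (x - y)) :=
  ((hη.comp_add_left y).comp_smul ht).comp_sub_right y

theorem fourier_comp_dilate (η : V → ℂ) {t : ℝ} (ht : 0 < t) (y ξ : V) :
    𝓕 (fun x => η (y + t • (x - y))) ξ =
      ((t ^ d)⁻¹ : ℝ) • (Real.fourierChar (-((1 - t⁻¹) * inner ℝ y ξ)) • 𝓕 η (t⁻¹ • ξ)) := by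
  let Θ (z : V) : ℂ := Real.fourierChar (-inner ℝ (t⁻¹ • (z + (t - 1) • y)) ξ) • η z
  have substitution (x : V) : Real.fourierChar (-inner ℝ x ξ) • η (y + t • (x - y)) =
      Θ (t • x + (-((t - 1) • y))) := by
    have hx : t • x + -((t - 1) • y) = y + t • (x - y) := by module
    simp only [Θ, hx]
    congr 4
    rw [show y + t • (x - y) + (t - 1) • y = t • x by module, inv_smul_smul₀ ht.ne']
  rw [Real.fourier_eq, Real.fourier_eq]
  simp_rw [substitution]
  rw [Measure.integral_comp_smul volume (fun x => Θ (x + (-((t - 1) • y)))),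
    integral_add_right_eq_self Θ, abs_of_pos (by positivity)]
  congr 1
  rw [Circle.smul_def, ← integral_smul]
  refine integral_congr_ae (.of_forall fun z => ?_)
  simp only [← Circle.smul_def, smul_smul, Θ, ← AddChar.map_add_eq_mul]
  congr 2
  simp only [inner_smul_left, inner_add_left, inner_smul_right, conj_trivial]
  field_simp
  ring

theorem integral_fourierChar_smul_mul_eq {g m : V → ℂ} (hg : Integrable g) (hm : Integrable m)
    (s : ℝ) :
    ∫ y, g y * ∫ ξ, Real.fourierChar (-(s * inner ℝ y ξ)) • m ξ = ∫ ξ, 𝓕 g (s • ξ) * m ξ := by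
  have h := VectorFourier.integral_fourierIntegral_smul_eq_flip (L := s • innerₗ V)
    Real.continuous_fourierChar (by simpa using! continuous_const.mul continuous_inner) hg hm
  have dilated (ξ : V) :
      VectorFourier.fourierIntegral Real.fourierChar volume (s • innerₗ V) g ξ = 𝓕 g (s • ξ) := by
    simp [Real.fourier_eq, VectorFourier.fourierIntegral, inner_smul_right]
  simp only [dilated, smul_eq_mul] at h
  exact h.symm

theorem integral_dilate_mul_fourier_eq {η w : V → ℂ} (hη : Integrable η) (hw : Integrable w)
    {t : ℝ} (ht : 0 < t) (y : V) :
    ∫ x, η (y + t • (x - y)) * 𝓕 w x = ((t ^ d)⁻¹ : ℝ) *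
      ∫ ξ, Real.fourierChar (-((1 - t⁻¹) * inner ℝ y ξ)) • (𝓕 η (t⁻¹ • ξ) * w ξ) := by
  rw [← integral_fourier_mul_eq (integrable_comp_dilate hη ht.ne' y) hw, ← integral_const_mul]
  simp only [fourier_comp_dilate η ht y, Circle.smul_def, Complex.real_smul, smul_eq_mul, mul_assoc]

theorem pairing_eq_fourier {t C : ℝ} (ht : 0 < t) {η g D : V → ℝ} {w : V → ℂ}
    (hη : Continuous η) (hηC : ∀ x, ‖η x‖ ≤ C) (hηi : Integrable η) (hg : Integrable g)
    (hD : Integrable D) (hw : Integrable w) (hDw : ∀ x, (D x : ℂ) = 𝓕 w x) :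
    (pairing t η g D : ℂ) = ((t ^ d)⁻¹ : ℝ) *
      ∫ ξ, 𝓕 (fun x => (g x : ℂ)) ((1 - t⁻¹) • ξ) *
        (𝓕 (fun x => (η x : ℂ)) (t⁻¹ • ξ) * w ξ) := by
  have multiplier_integrable : Integrable fun ξ => 𝓕 (fun x => (η x : ℂ)) (t⁻¹ • ξ) * w ξ :=
    hw.bdd_mul (c := ∫ x, ‖(η x : ℂ)‖)
      ((continuous_fourier hηi.ofReal).comp (by fun_prop)).aestronglyMeasurable
      (.of_forall fun _ => norm_fourier_le_integral_norm _ _)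
  calc (pairing t η g D : ℂ)
      = ∫ p : V × V, (η (p.2 + t • (p.1 - p.2)) : ℂ) * ((D p.1 : ℂ) * (g p.2 : ℂ)) := by
        rw [pairing, ← integral_complex_ofReal]
        simp only [Complex.ofReal_mul]
    _ = ∫ y, ∫ x, (η (y + t • (x - y)) : ℂ) * ((D x : ℂ) * (g y : ℂ)) := by
        rw [Measure.volume_eq_prod, integral_prod_symm]
        simpa using! (integrable_pairing (t := t) hη hηC hg hD).ofReal (𝕜 := ℂ)
    _ = ∫ y, ((t ^ d)⁻¹ : ℝ) * ((g y : ℂ) * ∫ ξ,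
          Real.fourierChar (-((1 - t⁻¹) * inner ℝ y ξ)) •
            (𝓕 (fun x => (η x : ℂ)) (t⁻¹ • ξ) * w ξ)) := by
        congr 1
        funext y
        rw [mul_left_comm, ← integral_dilate_mul_fourier_eq
            (η := fun x => (η x : ℂ)) hηi.ofReal hw ht y,
          ← integral_const_mul]
        simp only [hDw, mul_left_comm (g y : ℂ), mul_comm (g y : ℂ)]
    _ = _ := by
        rw [integral_const_mul, integral_fourierChar_smul_mul_eq (g := fun x => (g x : ℂ))
          hg.ofReal multiplier_integrable]

end Pairing

section FarKernel

open scoped ENNReal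

variable {V : Type*} [NormedAddCommGroup V]

theorem lintegral_div_sq_add_sq_le {a ρ : ℝ} (ha : 0 ≤ a) (hρ : 0 < ρ) :
    ∫⁻ t : ℝ, ENNReal.ofReal (a / (t ^ 2 + ρ ^ 2 * a ^ 2)) ≤ ENNReal.ofReal (Real.pi / ρ) := by
  rcases ha.eq_or_lt with rfl | ha
  · simp
  have hρa : 0 < ρ * a := by positivity
  have rescale (t : ℝ) : a / (t ^ 2 + ρ ^ 2 * a ^ 2) =
      a / (ρ * a) ^ 2 * (1 + (t / (ρ * a)) ^ 2)⁻¹ := by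
    field_simp
    ring
  simp_rw [rescale]
  rw [← ofReal_integral_eq_lintegral_ofReal
    ((integrable_inv_one_add_sq.comp_div hρa.ne').const_mul _) (.of_forall fun t => by positivity),
    integral_const_mul, Measure.integral_comp_div (fun x => (1 + x ^ 2)⁻¹),
    integral_univ_inv_one_add_sq, abs_of_pos hρa]
  refine le_of_eq (congrArg _ ?_)
  rw [smul_eq_mul]
  field_simp

theorem div_sq_add_sq_le_two_mul {a l t ρ : ℝ} (ha : 0 ≤ a) (hl : 1 / 2 ≤ l) (hl1 : l ≤ 1)
    (hρ : 0 < ρ) :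
    a / (t ^ 2 + ρ ^ 2 * a ^ 2) ≤ 2 * (l * a / (t ^ 2 + ρ ^ 2 * (l * a) ^ 2)) := by
  rcases ha.eq_or_lt with rfl | ha
  · simp
  have : 0 < l := by linarith
  rw [← mul_div_assoc]
  gcongr
  · nlinarith
  · nlinarith

/-- The Fourier-side weight of the forms `pairing t η g (∂_{v} φ)` for `t > 2`. Its integral over
`t` is bounded uniformly in `ξ`. -/
def farKernel (A ρ t : ℝ) (ξ : V) : ℝ≥0∞ :=
  ENNReal.ofReal (2 * Real.pi * A * (‖ξ‖ / (t ^ 2 + ρ ^ 2 * ‖ξ‖ ^ 2)))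

theorem lintegral_farKernel_le {A ρ : ℝ} (hA : 0 ≤ A) (hρ : 0 < ρ) (ξ : V) :
    ∫⁻ t : ℝ, farKernel A ρ t ξ ≤ ENNReal.ofReal (2 * Real.pi * A * (Real.pi / ρ)) := by
  have hA' : 0 ≤ 2 * Real.pi * A := by positivity
  simp only [farKernel, ENNReal.ofReal_mul hA']
  rw [lintegral_const_mul' _ _ ENNReal.ofReal_ne_top]
  gcongr
  exact lintegral_div_sq_add_sq_le (norm_nonneg _) hρ

theorem farKernel_le_two_mul [NormedSpace ℝ V] {A ρ t l : ℝ} (hA : 0 ≤ A) (hρ : 0 < ρ)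
    (hl : 1 / 2 ≤ l) (hl1 : l ≤ 1) (ξ : V) :
    farKernel A ρ t ξ ≤ 2 * farKernel A ρ t (l • ξ) := by
  rw [farKernel, farKernel, ← ENNReal.ofReal_ofNat, ← ENNReal.ofReal_mul (by norm_num), norm_smul,
    Real.norm_of_nonneg (by linarith), mul_left_comm]
  gcongr
  exact div_sq_add_sq_le_two_mul (norm_nonneg ξ) hl hl1 hρ

end FarKernel

section Complexify

open scoped LineDeriv
open SchwartzMap

variable {V : Type*} [NormedAddCommGroup V] [NormedSpace ℝ V]

/-- The complexification of a real Schwartz function, to which the Fourier transform applies. -/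
def complexify (φ : 𝓢(V, ℝ)) : 𝓢(V, ℂ) :=
  postcompCLM Complex.ofRealCLM φ

@[simp]
theorem complexify_apply (φ : 𝓢(V, ℝ)) (x : V) : complexify φ x = φ x :=
  rfl

theorem lineDerivOp_complexify (φ : 𝓢(V, ℝ)) (v : V) :
    ∂_{v} (complexify φ) = complexify (∂_{v} φ) := by
  ext x
  have chain_rule : fderiv ℝ (fun x => (φ x : ℂ)) x = Complex.ofRealCLM.comp (fderiv ℝ φ x) :=
    (Complex.ofRealCLM.hasFDerivAt.comp x φ.differentiableAt.hasFDerivAt).fderiv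
  rw [complexify_apply, lineDerivOp_apply_eq_fderiv, lineDerivOp_apply_eq_fderiv]
  change fderiv ℝ (fun x => (φ x : ℂ)) x v = _
  rw [chain_rule]
  rfl

end Complexify

section FarPart

open scoped FourierTransform ENNReal LineDeriv
open SchwartzMap

variable {V : Type*} [NormedAddCommGroup V] [InnerProductSpace ℝ V] [FiniteDimensional ℝ V]
  [MeasurableSpace V] [BorelSpace V]

local notation "d" => Module.finrank ℝ V

theorem lintegral_kernel_dilate_le {k f : V → ℝ≥0∞} {l : ℝ} (hl : 1 / 2 ≤ l)
    (hk : ∀ ξ, k ξ ≤ 2 * k (l • ξ)) :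
    ∫⁻ ξ, k ξ * f (l • ξ) ≤ 2 ^ (d + 1) * ∫⁻ ξ, k ξ * f ξ := by
  have hl0 : 0 < l := by linarith
  have jacobian_le : ENNReal.ofReal |(l ^ d)⁻¹| ≤ 2 ^ d := by
    rw [abs_of_pos (by positivity), ← inv_pow, ENNReal.ofReal_pow (by positivity)]
    gcongr
    rw [← ENNReal.ofReal_ofNat]
    exact ENNReal.ofReal_le_ofReal ((inv_le_comm₀ hl0 (by norm_num)).2 (by linarith))
  calc ∫⁻ ξ, k ξ * f (l • ξ)
      ≤ ∫⁻ ξ, 2 * (k (l • ξ) * f (l • ξ)) := by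
        refine lintegral_mono fun ξ => ?_
        rw [← mul_assoc]
        gcongr
        exact hk ξ
    _ = ENNReal.ofReal |(l ^ d)⁻¹| * (2 * ∫⁻ ξ, k ξ * f ξ) := by
        rw [lintegral_comp_smul volume (fun ζ => 2 * (k ζ * f ζ)) hl0.ne',
          lintegral_const_mul' _ _ (by norm_num)]
    _ ≤ 2 ^ (d + 1) * ∫⁻ ξ, k ξ * f ξ := by
        rw [pow_succ, mul_assoc]
        gcongr

theorem setLIntegral_lintegral_kernel_mul_le {k : ℝ → V → ℝ≥0∞} {C₀ : ℝ≥0∞} {s : Set ℝ}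
    (hkm : Measurable (Function.uncurry k)) (hkC : ∀ ξ, ∫⁻ t in s, k t ξ ≤ C₀)
    {f : V → ℝ≥0∞} (hf : Measurable f) :
    ∫⁻ t in s, ∫⁻ ξ, k t ξ * f ξ ≤ C₀ * ∫⁻ ξ, f ξ := by
  rw [lintegral_lintegral_swap (hkm.mul (hf.comp measurable_snd)).aemeasurable,
    ← lintegral_const_mul _ hf]
  refine lintegral_mono fun ξ => ?_
  have section_measurable : Measurable fun t => k t ξ := hkm.comp measurable_prodMk_right
  simp only
  rw [lintegral_mul_const _ section_measurable]
  gcongr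
  exact hkC ξ

theorem setLIntegral_lintegral_dilate_le {k : ℝ → V → ℝ≥0∞} {C₀ : ℝ≥0∞}
    (hkm : Measurable (Function.uncurry k)) (hkC : ∀ ξ, ∫⁻ t in Ioi (2 : ℝ), k t ξ ≤ C₀)
    (hkl : ∀ t l : ℝ, 1 / 2 ≤ l → l ≤ 1 → ∀ ξ, k t ξ ≤ 2 * k t (l • ξ))
    {F G : V → ℂ} (hF : Continuous F) (hG : Continuous G) :
    ∫⁻ t in Ioi (2 : ℝ), ∫⁻ ξ, k t ξ * (‖F ((1 - t⁻¹) • ξ)‖ₑ * ‖G ξ‖ₑ) ≤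
      2 ^ (d + 1) * C₀ * (eLpNorm F 2 volume * eLpNorm G 2 volume) := by
  have cauchy_schwarz := sq_lintegral_mul_mul_le
    (μ := (volume.restrict (Ioi (2 : ℝ))).prod (volume : Measure V))
    (k := Function.uncurry k) (f := fun p => ‖F ((1 - p.1⁻¹) • p.2)‖ₑ) (g := fun p => ‖G p.2‖ₑ)
    hkm.aemeasurable (by fun_prop) (by fun_prop)
  rw [lintegral_prod _ (by fun_prop), lintegral_prod _ (by fun_prop),
    lintegral_prod _ (by fun_prop)] at cauchy_schwarz
  simp only [Function.uncurry_apply_pair] at cauchy_schwarz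
  have bound_F : ∫⁻ t in Ioi (2 : ℝ), ∫⁻ ξ, k t ξ * ‖F ((1 - t⁻¹) • ξ)‖ₑ ^ 2 ≤
      2 ^ (d + 1) * (C₀ * eLpNorm F 2 volume ^ 2) := by
    calc ∫⁻ t in Ioi (2 : ℝ), ∫⁻ ξ, k t ξ * ‖F ((1 - t⁻¹) • ξ)‖ₑ ^ 2
        ≤ ∫⁻ t in Ioi (2 : ℝ), 2 ^ (d + 1) * ∫⁻ ξ, k t ξ * ‖F ξ‖ₑ ^ 2 := by
          refine setLIntegral_mono' measurableSet_Ioi fun t (ht : 2 < t) => ?_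
          have inv_le : t⁻¹ ≤ 2⁻¹ := by gcongr
          have inv_pos : 0 < t⁻¹ := by positivity
          exact lintegral_kernel_dilate_le (f := fun ξ => ‖F ξ‖ₑ ^ 2) (by linarith)
            (hkl t _ (by linarith) (by linarith))
      _ ≤ 2 ^ (d + 1) * (C₀ * eLpNorm F 2 volume ^ 2) := by
          rw [lintegral_const_mul' _ _ (by simp), eLpNorm_two_sq]
          gcongr
          exact setLIntegral_lintegral_kernel_mul_le hkm hkC (by fun_prop)
  have bound_G : ∫⁻ t in Ioi (2 : ℝ), ∫⁻ ξ, k t ξ * ‖G ξ‖ₑ ^ 2 ≤ C₀ * eLpNorm G 2 volume ^ 2 := by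
    rw [eLpNorm_two_sq]
    exact setLIntegral_lintegral_kernel_mul_le hkm hkC (by fun_prop)
  refine (ENNReal.pow_le_pow_left_iff two_ne_zero).1
    (cauchy_schwarz.trans ((mul_le_mul' bound_F bound_G).trans ?_))
  calc 2 ^ (d + 1) * (C₀ * eLpNorm F 2 volume ^ 2) * (C₀ * eLpNorm G 2 volume ^ 2)
      = 2 ^ (d + 1) * 1 * (C₀ * eLpNorm F 2 volume * eLpNorm G 2 volume) ^ 2 := by ring
    _ ≤ 2 ^ (d + 1) * 2 ^ (d + 1) * (C₀ * eLpNorm F 2 volume * eLpNorm G 2 volume) ^ 2 := by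
        gcongr
        exact one_le_pow₀ (by norm_num)
    _ = _ := by ring

theorem norm_fourierInv_lineDerivOp_le (Φ : 𝓢(V, ℂ)) (v ξ : V) :
    ‖(𝓕⁻ (∂_{v} Φ)) ξ‖ ≤ 2 * Real.pi * (‖ξ‖ * ‖v‖) * ‖(𝓕⁻ Φ) ξ‖ := by
  have growth : (inner ℝ · v : V → ℝ).HasTemperateGrowth := by fun_prop
  rw [fourierInv_lineDerivOp_eq]
  simp only [smul_apply, smulLeftCLM_apply_apply growth, norm_smul]
  rw [← mul_assoc]
  gcongr
  · simp [abs_of_pos Real.pi_pos]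
  · exact norm_inner_le_norm ξ v

theorem enorm_pairing_lineDerivOp_le_lintegral {η g : V → ℝ} {A C ρ t : ℝ} (ht : 0 < t)
    (hη : Continuous η) (hηC : ∀ x, ‖η x‖ ≤ C) (hηi : Integrable η)
    (hdecay : ∀ ξ, ‖𝓕 (fun x => (η x : ℂ)) ξ‖ ≤ A / (1 + ρ ^ 2 * ‖ξ‖ ^ 2))
    (hg : Integrable g) (φ : 𝓢(V, ℝ)) {v : V} (hv : ‖v‖ ≤ 1) :
    ENNReal.ofReal (t ^ d / t ^ 2) * ‖pairing t η g (∂_{v} φ : 𝓢(V, ℝ))‖ₑ ≤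
      ∫⁻ ξ, farKernel A ρ t ξ *
        (‖𝓕 (fun x => (g x : ℂ)) ((1 - t⁻¹) • ξ)‖ₑ * ‖(𝓕⁻ (complexify φ)) ξ‖ₑ) := by
  have fourier_side := pairing_eq_fourier (t := t) (D := (∂_{v} φ : 𝓢(V, ℝ))) ht hη hηC hηi hg
    (∂_{v} φ).integrable (𝓕⁻ (∂_{v} (complexify φ))).integrable fun x => by
      rw [← fourier_coe, FourierTransform.fourier_fourierInv_eq, lineDerivOp_complexify,
        complexify_apply]
  have enorm_cast : ‖pairing t η g (∂_{v} φ : 𝓢(V, ℝ))‖ₑ =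
      ‖(pairing t η g (∂_{v} φ : 𝓢(V, ℝ)) : ℂ)‖ₑ := by
    rw [← ofReal_norm, ← ofReal_norm, Complex.norm_real]
  rw [enorm_cast, fourier_side, ← integral_const_mul]
  refine (mul_le_mul_right (enorm_integral_le_lintegral_enorm _) _).trans ?_
  rw [← lintegral_const_mul' _ _ ENNReal.ofReal_ne_top]
  refine lintegral_mono fun ξ => ?_
  rw [farKernel, ← ofReal_norm, ← ofReal_norm, ← ofReal_norm, ← ENNReal.ofReal_mul (by positivity),
    ← ENNReal.ofReal_mul (by positivity), ← ENNReal.ofReal_mul' (by positivity)]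
  refine ENNReal.ofReal_le_ofReal ?_
  rw [norm_mul, norm_mul, norm_mul, Complex.norm_real, Real.norm_of_nonneg (by positivity)]
  have derivative_le : ‖(𝓕⁻ (∂_{v} (complexify φ))) ξ‖ ≤
      2 * Real.pi * ‖ξ‖ * ‖(𝓕⁻ (complexify φ)) ξ‖ := by
    refine (norm_fourierInv_lineDerivOp_le (complexify φ) v ξ).trans ?_
    gcongr
    exact mul_le_of_le_one_right (norm_nonneg ξ) hv
  set G := ‖𝓕 (fun x => (g x : ℂ)) ((1 - t⁻¹) • ξ)‖
  calc t ^ d / t ^ 2 * ((t ^ d)⁻¹ * (G * (‖𝓕 (fun x => (η x : ℂ)) (t⁻¹ • ξ)‖ *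
        ‖(𝓕⁻ (∂_{v} (complexify φ))) ξ‖)))
      ≤ t ^ d / t ^ 2 * ((t ^ d)⁻¹ * (G * (A / (1 + ρ ^ 2 * ‖t⁻¹ • ξ‖ ^ 2) *
          (2 * Real.pi * ‖ξ‖ * ‖(𝓕⁻ (complexify φ)) ξ‖)))) := by
        gcongr
        · exact (norm_nonneg _).trans (hdecay _)
        · exact hdecay _
    _ = _ := by
        rw [norm_smul, norm_inv, Real.norm_of_nonneg ht.le]
        field_simp

theorem setLIntegral_Ioi_two_pairing_le {η g : V → ℝ} {A C ρ : ℝ} (hA : 0 ≤ A) (hρ : 0 < ρ)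
    (hη : Continuous η) (hηC : ∀ x, ‖η x‖ ≤ C) (hηi : Integrable η)
    (hdecay : ∀ ξ, ‖𝓕 (fun x => (η x : ℂ)) ξ‖ ≤ A / (1 + ρ ^ 2 * ‖ξ‖ ^ 2))
    (hg : Integrable g) (hg2 : MemLp g 2) (φ : 𝓢(V, ℝ)) {v : V} (hv : ‖v‖ ≤ 1) :
    ∫⁻ t in Ioi (2 : ℝ), ENNReal.ofReal (t ^ d / t ^ 2) * ‖pairing t η g (∂_{v} φ : 𝓢(V, ℝ))‖ₑ ≤
      ENNReal.ofReal (2 ^ (d + 2) * Real.pi ^ 2 * (A / ρ)) *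
        (eLpNorm g 2 volume * eLpNorm φ 2 volume) := by
  have norm_g : eLpNorm (𝓕 fun x => (g x : ℂ)) 2 volume = eLpNorm g 2 volume := by
    rw [eLpNorm_fourier_eq (f := fun x => (g x : ℂ)) hg.ofReal hg2.ofReal]
    exact eLpNorm_congr_norm_ae (.of_forall fun x => by simp)
  have norm_φ : eLpNorm (𝓕⁻ (complexify φ) : 𝓢(V, ℂ)) 2 volume = eLpNorm φ 2 volume := by
    rw [eLpNorm_fourierInv_schwartzMap_eq]
    exact eLpNorm_congr_norm_ae (.of_forall fun x => by simp)
  calc ∫⁻ t in Ioi (2 : ℝ), ENNReal.ofReal (t ^ d / t ^ 2) * ‖pairing t η g (∂_{v} φ : 𝓢(V, ℝ))‖ₑ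
      ≤ ∫⁻ t in Ioi (2 : ℝ), ∫⁻ ξ, farKernel A ρ t ξ *
          (‖𝓕 (fun x => (g x : ℂ)) ((1 - t⁻¹) • ξ)‖ₑ * ‖(𝓕⁻ (complexify φ)) ξ‖ₑ) :=
        setLIntegral_mono' measurableSet_Ioi fun t (ht : 2 < t) =>
          enorm_pairing_lineDerivOp_le_lintegral (by linarith) hη hηC hηi hdecay hg φ hv
    _ ≤ 2 ^ (d + 1) * ENNReal.ofReal (2 * Real.pi * A * (Real.pi / ρ)) *
          (eLpNorm g 2 volume * eLpNorm φ 2 volume) := by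
        rw [← norm_g, ← norm_φ]
        exact setLIntegral_lintegral_dilate_le
          (by simp only [farKernel, Function.uncurry_def]; fun_prop)
          (fun ξ => (setLIntegral_le_lintegral _ _).trans (lintegral_farKernel_le hA hρ ξ))
          (fun t l hl hl1 ξ => farKernel_le_two_mul hA hρ hl hl1 ξ)
          (continuous_fourier hg.ofReal) (𝓕⁻ (complexify φ) : 𝓢(V, ℂ)).continuous
    _ = _ := by
        rw [← ENNReal.ofReal_ofNat, ← ENNReal.ofReal_pow (by norm_num),
          ← ENNReal.ofReal_mul (by positivity)]
        congr 2
        ring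

end FarPart

section SchurTest

open scoped ENNReal

variable {α β : Type*} [MeasurableSpace α] [MeasurableSpace β] {μ : Measure α} {ν : Measure β}
  {k : α × β → ℝ≥0∞}

theorem lintegral_prod_mul_fst_le [SFinite ν] {C₀ : ℝ≥0∞} (hk : Measurable k)
    (hC₀ : ∀ x, ∫⁻ y, k (x, y) ∂ν ≤ C₀) {f : α → ℝ≥0∞} (hf : AEMeasurable f μ) :
    ∫⁻ p, k p * f p.1 ∂μ.prod ν ≤ C₀ * ∫⁻ x, f x ∂μ := by
  rw [lintegral_prod _ (by exact hk.aemeasurable.mul hf.comp_fst), ← lintegral_const_mul'' _ hf]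
  refine lintegral_mono fun x => ?_
  simp only
  rw [lintegral_mul_const _ (by exact hk.comp measurable_prodMk_left)]
  gcongr
  exact hC₀ x

theorem schur_test [SFinite μ] [SFinite ν] {A B : ℝ≥0∞} {f : α → ℝ} {g : β → ℝ}
    (hk : Measurable k) (hA : ∀ x, ∫⁻ y, k (x, y) ∂ν ≤ A) (hB : ∀ y, ∫⁻ x, k (x, y) ∂μ ≤ B)
    (hf : AEStronglyMeasurable f μ) (hg : AEStronglyMeasurable g ν) :
    (∫⁻ p, k p * (‖f p.1‖ₑ * ‖g p.2‖ₑ) ∂μ.prod ν) ^ 2 ≤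
      A * B * (eLpNorm f 2 μ * eLpNorm g 2 ν) ^ 2 := by
  have swap : ∫⁻ p, k p * ‖g p.2‖ₑ ^ 2 ∂μ.prod ν = ∫⁻ p, k p.swap * ‖g p.1‖ₑ ^ 2 ∂ν.prod μ :=
    (lintegral_prod_swap (μ := μ) (ν := ν) (fun p => k p * ‖g p.2‖ₑ ^ 2)).symm
  calc (∫⁻ p, k p * (‖f p.1‖ₑ * ‖g p.2‖ₑ) ∂μ.prod ν) ^ 2
      ≤ (∫⁻ p, k p * ‖f p.1‖ₑ ^ 2 ∂μ.prod ν) * ∫⁻ p, k p * ‖g p.2‖ₑ ^ 2 ∂μ.prod ν :=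
        sq_lintegral_mul_mul_le hk.aemeasurable hf.comp_fst.enorm hg.comp_snd.enorm
    _ ≤ (A * eLpNorm f 2 μ ^ 2) * (B * eLpNorm g 2 ν ^ 2) := by
        rw [swap, eLpNorm_two_sq, eLpNorm_two_sq]
        gcongr
        · exact lintegral_prod_mul_fst_le hk hA (hf.enorm.pow_const 2)
        · exact lintegral_prod_mul_fst_le (hk.comp measurable_swap) hB (hg.enorm.pow_const 2)
    _ = _ := by ring

end SchurTest

section NearPart

open scoped ENNReal LineDeriv
open SchwartzMap

variable {V : Type*} [NormedAddCommGroup V] [InnerProductSpace ℝ V] [FiniteDimensional ℝ V]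
  [MeasurableSpace V] [BorelSpace V]

local notation "d" => Module.finrank ℝ V

theorem integral_dilate_mul_lineDerivOp (t : ℝ) (η φ : 𝓢(V, ℝ)) (y v : V) :
    ∫ x, η (y + t • (x - y)) * ∂_{v} φ x =
      -(t * ∫ x, ∂_{v} η (y + t • (x - y)) * φ x) := by
  have dilate_hasFDerivAt (x : V) : HasFDerivAt (fun x => y + t • (x - y))
      (t • ContinuousLinearMap.id ℝ V) x :=
    (((hasFDerivAt_id x).sub_const y).const_smul t).const_add y
  have comp_hasFDerivAt (x : V) : HasFDerivAt (fun x => η (y + t • (x - y)))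
      ((fderiv ℝ η (y + t • (x - y))).comp (t • ContinuousLinearMap.id ℝ V)) x :=
    η.differentiableAt.hasFDerivAt.comp x (dilate_hasFDerivAt x)
  have comp_fderiv (x : V) : fderiv ℝ (fun x => η (y + t • (x - y))) x v =
      t * ∂_{v} η (y + t • (x - y)) := by
    rw [(comp_hasFDerivAt x).fderiv, lineDerivOp_apply_eq_fderiv]
    simp
  have integrable_mul (ζ ψ : 𝓢(V, ℝ)) : Integrable fun x => ζ (y + t • (x - y)) * ψ x :=
    ψ.integrable.bdd_mul (c := SchwartzMap.seminorm ℝ 0 0 ζ) (by fun_prop)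
      (.of_forall fun _ => SchwartzMap.norm_le_seminorm ℝ ζ _)
  have by_parts := integral_mul_fderiv_eq_neg_fderiv_mul_of_integrable
    (μ := (volume : Measure V)) (f := fun x => η (y + t • (x - y))) (g := φ) (v := v)
    (by simpa only [comp_fderiv, mul_assoc] using (integrable_mul (∂_{v} η) φ).const_mul t)
    (by simpa only [lineDerivOp_apply_eq_fderiv] using integrable_mul η (∂_{v} φ))
    (integrable_mul η φ) (fun x _ => (comp_hasFDerivAt x).differentiableAt)
    (fun x _ => φ.differentiableAt)
  simpa only [comp_fderiv, mul_assoc, integral_const_mul, ← lineDerivOp_apply_eq_fderiv]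
    using by_parts

theorem pairing_lineDerivOp (t : ℝ) (η φ : 𝓢(V, ℝ)) {g : V → ℝ} (hg : Integrable g) (v : V) :
    pairing t η g (∂_{v} φ : 𝓢(V, ℝ)) = -(t * pairing t (∂_{v} η : 𝓢(V, ℝ)) g φ) := by
  have pairing_eq_iterated (ζ ψ : 𝓢(V, ℝ)) :
      pairing t ζ g ψ = ∫ y, (∫ x, ζ (y + t • (x - y)) * ψ x) * g y := by
    rw [pairing, Measure.volume_eq_prod, integral_prod_symm _ (by
      exact integrable_pairing ζ.continuous (SchwartzMap.norm_le_seminorm ℝ ζ) hg ψ.integrable)]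
    simp only [← mul_assoc, integral_mul_const]
  simp only [pairing_eq_iterated, integral_dilate_mul_lineDerivOp, neg_mul, integral_neg, mul_assoc,
    integral_const_mul]

variable {ψ g φ : V → ℝ} {Ω : Set V} {M Q t : ℝ}

theorem lintegral_dilate_mul_indicator_le (hΩ : MeasurableSet Ω) (hM : 0 ≤ M) (ht : 1 < t)
    (hψ1 : ∫⁻ x, ‖ψ x‖ₑ ≤ ENNReal.ofReal M)
    (hψΩ : ∀ x, ‖ψ x‖ₑ * volume Ω ≤ ENNReal.ofReal (M * Q)) (x : V) :
    ∫⁻ y, ‖ψ (y + t • (x - y))‖ₑ * Ω.indicator 1 y ≤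
      ENNReal.ofReal (M * min ((t - 1) ^ d)⁻¹ Q) := by
  have : 0 < t - 1 := by linarith
  rw [mul_min_of_nonneg _ _ hM, ENNReal.ofReal_min]
  refine le_min ?_ ?_
  · calc ∫⁻ y, ‖ψ (y + t • (x - y))‖ₑ * Ω.indicator 1 y ≤ ∫⁻ y, ‖ψ (y + t • (x - y))‖ₑ :=
          lintegral_mono fun y => mul_le_of_le_one_right' (indicator_le_self' (by simp) y)
      _ ≤ _ := by
          rw [lintegral_dilate_right volume (fun z => ‖ψ z‖ₑ) ht, mul_comm M,
            ENNReal.ofReal_mul (by positivity)]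
          gcongr
  · calc ∫⁻ y, ‖ψ (y + t • (x - y))‖ₑ * Ω.indicator 1 y
        ≤ ∫⁻ y, (⨆ z, ‖ψ z‖ₑ) * Ω.indicator 1 y := by
          gcongr with y
          exact le_iSup (fun z => ‖ψ z‖ₑ) _
      _ ≤ _ := by
          rw [lintegral_const_mul _ (measurable_one.indicator hΩ), lintegral_indicator_one hΩ,
            ENNReal.iSup_mul]
          exact iSup_le hψΩ

theorem lintegral_dilate_left_le (ht : 1 < t) (hψ1 : ∫⁻ x, ‖ψ x‖ₑ ≤ ENNReal.ofReal M) (y : V) :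
    ∫⁻ x, ‖ψ (y + t • (x - y))‖ₑ ≤ ENNReal.ofReal M := by
  rw [lintegral_dilate_left volume (fun z => ‖ψ z‖ₑ) (by linarith), ← one_mul (ENNReal.ofReal M)]
  gcongr
  rw [← ENNReal.ofReal_one]
  exact ENNReal.ofReal_le_ofReal (inv_le_one_of_one_le₀ (one_le_pow₀ ht.le))

theorem enorm_pairing_le (ht : 1 < t) (hΩ : MeasurableSet Ω) (hM : 0 ≤ M) (hQ : 0 ≤ Q)
    (hψ : Continuous ψ) (hψ1 : ∫⁻ x, ‖ψ x‖ₑ ≤ ENNReal.ofReal M)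
    (hψΩ : ∀ x, ‖ψ x‖ₑ * volume Ω ≤ ENNReal.ofReal (M * Q))
    (hg : AEStronglyMeasurable g) (hgΩ : ∀ y ∉ Ω, g y = 0) (hφ : AEStronglyMeasurable φ) :
    ‖pairing t ψ g φ‖ₑ ≤ ENNReal.ofReal (M * √(min ((t - 1) ^ d)⁻¹ Q)) *
      (eLpNorm g 2 volume * eLpNorm φ 2 volume) := by
  have : 0 < t - 1 := by linarith
  set N : ℝ := min ((t - 1) ^ d)⁻¹ Q
  have hN : 0 ≤ N := by positivity
  let k (p : V × V) : ℝ≥0∞ := ‖ψ (p.2 + t • (p.1 - p.2))‖ₑ * Ω.indicator 1 p.2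
  have hk : Measurable k :=
    (by fun_prop : Continuous fun p : V × V => ψ (p.2 + t • (p.1 - p.2))).measurable.enorm.mul
      ((measurable_one.indicator hΩ).comp measurable_snd)
  have enorm_le : ‖pairing t ψ g φ‖ₑ ≤ ∫⁻ p : V × V, k p * (‖φ p.1‖ₑ * ‖g p.2‖ₑ) := by
    refine (enorm_integral_le_lintegral_enorm _).trans (lintegral_mono fun p => ?_)
    by_cases hp : p.2 ∈ Ω
    · simp [k, hp, enorm_mul]
    · simp [hgΩ _ hp]
  have const_sq : ENNReal.ofReal (M * √N) ^ 2 = ENNReal.ofReal (M * N) * ENNReal.ofReal M := by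
    rw [← ENNReal.ofReal_pow (by positivity), ← ENNReal.ofReal_mul (by positivity), mul_pow,
      Real.sq_sqrt hN]
    ring_nf
  refine enorm_le.trans ((ENNReal.pow_le_pow_left_iff two_ne_zero).1 ?_)
  rw [mul_pow, const_sq, mul_comm (eLpNorm g 2 volume)]
  exact schur_test hk (lintegral_dilate_mul_indicator_le hΩ hM ht hψ1 hψΩ)
    (fun y => (lintegral_mono fun x =>
      mul_le_of_le_one_right' (indicator_le_self' (by simp) y)).trans
      (lintegral_dilate_left_le ht hψ1 y)) hφ hg

end NearPart

section Kappa

theorem one_le_kappa (n ℓ : ℕ) {q : ℝ} (hq : 1 ≤ q) : 1 ≤ kappa n ℓ q := by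
  unfold kappa
  split_ifs
  · exact le_rfl
  · have := Real.log_nonneg hq
    exact le_add_of_nonneg_right (by positivity)

theorem kappa_of_le {n k : ℕ} (h : n ≤ 2 * k) (q : ℝ) :
    kappa n (k + 1) q = 1 + Real.log q ^ ((n : ℝ) / (2 * k)) *
      q ^ ((2 * (k : ℝ) - n) / (2 * k)) := by
  have h' : (n : ℝ) ≤ 2 * k := by exact_mod_cast h
  have not_lt : ¬ ((k + 1 : ℕ) : ℝ) < (n : ℝ) / 2 + 1 := by
    push_cast
    linarith
  rw [kappa, if_neg not_lt]
  push_cast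
  simp only [add_sub_cancel_right]

theorem kappa_of_eq {n k : ℕ} (hk : 0 < k) (h : n = 2 * k) (q : ℝ) :
    kappa n (k + 1) q = 1 + Real.log q := by
  have hk' : (2 * k : ℝ) ≠ 0 := by positivity
  rw [kappa_of_le h.le, h, Nat.cast_mul, Nat.cast_two, div_self hk', sub_self, zero_div,
    Real.rpow_one, Real.rpow_zero, mul_one]

theorem rpow_le_exp_mul_kappa {n k : ℕ} (hk : k + 1 ≤ n) (h : n ≤ 2 * k) {q : ℝ} (hq : 1 ≤ q) :
    q ^ ((2 * (k : ℝ) - n) / (2 * n)) ≤ Real.exp 1 * kappa n (k + 1) q := by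
  have hn : (0 : ℝ) < n := by exact_mod_cast (by omega : 0 < n)
  have hk0 : (0 : ℝ) < k := by exact_mod_cast (by omega : 0 < k)
  have hkn : (k : ℝ) ≤ n := by exact_mod_cast (by omega : k ≤ n)
  have h' : (n : ℝ) ≤ 2 * k := by exact_mod_cast h
  have one_le_exp : (1 : ℝ) ≤ Real.exp 1 := Real.one_le_exp zero_le_one
  have hκ := one_le_kappa n (k + 1) hq
  rcases le_or_gt 1 (Real.log q) with one_le_log | log_lt
  · have exponent_le : (2 * (k : ℝ) - n) / (2 * n) ≤ (2 * (k : ℝ) - n) / (2 * k) := by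
      apply div_le_div_of_nonneg_left <;> linarith
    calc q ^ ((2 * (k : ℝ) - n) / (2 * n)) ≤ 1 * q ^ ((2 * (k : ℝ) - n) / (2 * k)) := by
          rw [one_mul]
          exact Real.rpow_le_rpow_of_exponent_le hq exponent_le
      _ ≤ Real.log q ^ ((n : ℝ) / (2 * k)) * q ^ ((2 * (k : ℝ) - n) / (2 * k)) := by
          gcongr
          exact Real.one_le_rpow one_le_log (by positivity)
      _ ≤ kappa n (k + 1) q := by
          rw [kappa_of_le h]
          linarith
      _ ≤ _ := le_mul_of_one_le_left (by linarith) one_le_exp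
  · have hqe : q ≤ Real.exp 1 := (Real.log_le_iff_le_exp (by linarith)).1 log_lt.le
    have exponent_le : (2 * (k : ℝ) - n) / (2 * n) ≤ 1 := by
      rw [div_le_one (by positivity)]
      linarith
    calc q ^ ((2 * (k : ℝ) - n) / (2 * n)) ≤ q ^ (1 : ℝ) :=
          Real.rpow_le_rpow_of_exponent_le hq exponent_le
      _ ≤ Real.exp 1 * 1 := by simpa using hqe
      _ ≤ _ := by gcongr

end Kappa

section MinIntegral

open scoped ENNReal

theorem setLIntegral_rpow_Ioc {a b r : ℝ} (ha : 0 ≤ a) (hab : a ≤ b)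
    (h : -1 < r ∨ (r ≠ -1 ∧ 0 < a)) :
    ∫⁻ τ in Ioc a b, ENNReal.ofReal (τ ^ r) =
      ENNReal.ofReal ((b ^ (r + 1) - a ^ (r + 1)) / (r + 1)) := by
  have hor : -1 < r ∨ r ≠ -1 ∧ (0 : ℝ) ∉ uIcc a b := by
    refine h.imp_right fun h => ⟨h.1, ?_⟩
    rw [uIcc_of_le hab]
    exact fun h0 => absurd h0.1 (not_le.2 h.2)
  rw [← integral_rpow hor, intervalIntegral.integral_of_le hab,
    ofReal_integral_eq_lintegral_ofReal]
  · rw [← IntegrableOn, ← intervalIntegrable_iff_integrableOn_Ioc_of_le hab]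
    rcases hor with h | h
    · exact intervalIntegral.intervalIntegrable_rpow' h
    · exact intervalIntegral.intervalIntegrable_rpow (Or.inr h.2)
  · filter_upwards [ae_restrict_mem measurableSet_Ioc] with τ hτ
    exact Real.rpow_nonneg (ha.trans hτ.1.le) _

theorem setLIntegral_inv_Ioc {a b : ℝ} (ha : 0 < a) (hab : a ≤ b) :
    ∫⁻ τ in Ioc a b, ENNReal.ofReal τ⁻¹ = ENNReal.ofReal (Real.log (b / a)) := by
  have h0 : (0 : ℝ) ∉ uIcc a b := by
    rw [uIcc_of_le hab]
    exact fun h0 => absurd h0.1 (not_le.2 ha)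
  rw [← integral_inv_of_pos ha (ha.trans_le hab), intervalIntegral.integral_of_le hab,
    ofReal_integral_eq_lintegral_ofReal]
  · rw [← IntegrableOn, ← intervalIntegrable_iff_integrableOn_Ioc_of_le hab]
    exact intervalIntegral.intervalIntegrable_inv (fun x hx h => h0 (h ▸ hx)) continuousOn_id
  · filter_upwards [ae_restrict_mem measurableSet_Ioc] with τ hτ
    exact inv_nonneg.2 (ha.le.trans hτ.1.le)

theorem pow_mul_sqrt_min_inv_pow_le (m n : ℕ) {τ : ℝ} (hτ : 0 < τ) (Q : ℝ) :
    τ ^ m * √(min (τ ^ n)⁻¹ Q) ≤ τ ^ ((m : ℝ) - n / 2) := by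
  calc τ ^ m * √(min (τ ^ n)⁻¹ Q) ≤ τ ^ m * √((τ ^ n)⁻¹) := by
        gcongr
        exact min_le_left _ _
    _ = τ ^ ((m : ℝ) - n / 2) := by
        rw [Real.sqrt_eq_rpow, ← Real.rpow_natCast, ← Real.rpow_natCast, ← Real.rpow_neg hτ.le,
          ← Real.rpow_mul hτ.le, ← Real.rpow_add hτ]
        congr 1
        ring

theorem setLIntegral_min_le_two {m n : ℕ} (h : n ≤ 2 * m + 1) (Q : ℝ) :
    ∫⁻ τ in Ioc (0 : ℝ) 1, ENNReal.ofReal (τ ^ m * √(min (τ ^ n)⁻¹ Q)) ≤ ENNReal.ofReal 2 := by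
  have h' : (n : ℝ) ≤ 2 * m + 1 := by exact_mod_cast h
  calc ∫⁻ τ in Ioc (0 : ℝ) 1, ENNReal.ofReal (τ ^ m * √(min (τ ^ n)⁻¹ Q))
      ≤ ∫⁻ τ in Ioc (0 : ℝ) 1, ENNReal.ofReal (τ ^ (-(1 / 2) : ℝ)) :=
        setLIntegral_mono' measurableSet_Ioc fun τ hτ => ENNReal.ofReal_le_ofReal <|
          (pow_mul_sqrt_min_inv_pow_le m n hτ.1 Q).trans <|
            Real.rpow_le_rpow_of_exponent_ge hτ.1 hτ.2 (by linarith)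
    _ = ENNReal.ofReal 2 := by
        rw [setLIntegral_rpow_Ioc le_rfl zero_le_one (Or.inl (by norm_num))]
        norm_num

theorem setLIntegral_Ioc_zero_min_le (m n : ℕ) {Q τ₀ : ℝ} (hτ₀ : 0 ≤ τ₀) :
    ∫⁻ τ in Ioc (0 : ℝ) τ₀, ENNReal.ofReal (τ ^ m * √(min (τ ^ n)⁻¹ Q)) ≤
      ENNReal.ofReal (τ₀ ^ (m + 1) * √Q) := by
  calc ∫⁻ τ in Ioc (0 : ℝ) τ₀, ENNReal.ofReal (τ ^ m * √(min (τ ^ n)⁻¹ Q))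
      ≤ ∫⁻ _ in Ioc (0 : ℝ) τ₀, ENNReal.ofReal (τ₀ ^ m * √Q) := by
        refine setLIntegral_mono' measurableSet_Ioc fun _ hτ => ENNReal.ofReal_le_ofReal ?_
        have := hτ.1.le
        have := hτ.2
        gcongr
        exact min_le_right _ _
    _ = ENNReal.ofReal (τ₀ ^ (m + 1) * √Q) := by
        rw [setLIntegral_const, Real.volume_Ioc, sub_zero, ← ENNReal.ofReal_mul (by positivity)]
        congr 1
        ring

theorem rpow_neg_inv_pow_mul_sqrt {n k : ℕ} (hk : k + 1 ≤ n) {q : ℝ} (hq : 0 < q) :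
    (q ^ (-(1 / n) : ℝ)) ^ (n - (k + 1) + 1) * √q = q ^ ((2 * (k : ℝ) - n) / (2 * n)) := by
  have hn : (n : ℝ) ≠ 0 := by exact_mod_cast (by omega : n ≠ 0)
  rw [← Real.rpow_natCast, ← Real.rpow_mul hq.le, Real.sqrt_eq_rpow, ← Real.rpow_add hq,
    Nat.cast_add, Nat.cast_sub hk]
  congr 1
  field_simp
  push_cast
  ring

theorem setLIntegral_rpow_le_kappa {n k : ℕ} (hk : k + 1 ≤ n) (h : n ≤ 2 * k) {q : ℝ}
    (hq : 1 ≤ q) :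
    ∫⁻ τ in Ioc (q ^ (-(1 / n) : ℝ)) 1, ENNReal.ofReal (τ ^ (-1 - (2 * (k : ℝ) - n) / 2)) ≤
      ENNReal.ofReal (2 * (Real.exp 1 * kappa n (k + 1) q)) := by
  have hn : (1 : ℝ) ≤ n := by exact_mod_cast (by omega : 1 ≤ n)
  have hq0 : 0 < q := by linarith
  set τ₀ : ℝ := q ^ (-(1 / n) : ℝ) with τ₀_def
  have τ₀_pos : 0 < τ₀ := Real.rpow_pos_of_pos hq0 _
  have τ₀_le : τ₀ ≤ 1 := Real.rpow_le_one_of_one_le_of_nonpos hq (neg_nonpos.2 (by positivity))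
  rcases h.eq_or_lt with h | h
  · have log_le : Real.log (1 / τ₀) ≤ Real.log q := by
      rw [one_div, Real.log_inv, τ₀_def, Real.log_rpow hq0, neg_mul, neg_neg, one_div]
      exact mul_le_of_le_one_left (Real.log_nonneg hq) (inv_le_one_of_one_le₀ hn)
    have one_le_exp : (1 : ℝ) ≤ Real.exp 1 := Real.one_le_exp zero_le_one
    have hκ : Real.log q ≤ kappa n (k + 1) q := by
      rw [kappa_of_eq (by omega) h]
      linarith
    have hκ1 := one_le_kappa n (k + 1) hq
    have exponent_eq : -1 - (2 * (k : ℝ) - n) / 2 = -1 := by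
      rw [h]
      push_cast
      ring
    simp only [exponent_eq, Real.rpow_neg_one]
    rw [setLIntegral_inv_Ioc τ₀_pos τ₀_le]
    refine ENNReal.ofReal_le_ofReal (log_le.trans (hκ.trans ?_))
    nlinarith
  · have h' : (n : ℝ) + 1 ≤ 2 * k := by exact_mod_cast h
    have rpow_τ₀ : τ₀ ^ (-1 - (2 * (k : ℝ) - n) / 2 + 1) = q ^ ((2 * (k : ℝ) - n) / (2 * n)) := by
      rw [τ₀_def, ← Real.rpow_mul hq0.le]
      congr 1
      field_simp
      ring
    rw [setLIntegral_rpow_Ioc τ₀_pos.le τ₀_le (Or.inr ⟨by linarith, τ₀_pos⟩), Real.one_rpow,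
      rpow_τ₀]
    refine ENNReal.ofReal_le_ofReal (le_trans ?_
      (mul_le_mul_of_nonneg_left (rpow_le_exp_mul_kappa hk h.le hq) zero_le_two))
    have : 0 ≤ q ^ ((2 * (k : ℝ) - n) / (2 * n)) := by positivity
    rw [div_le_iff_of_neg (by linarith)]
    nlinarith

/- For `n ≤ 2k` the integral is split at `τ = q ^ (-1/n)`, where the two terms of the minimum
balance. -/
theorem setLIntegral_min_le_kappa {n k : ℕ} (hk : k + 1 ≤ n) {c q : ℝ} (hc : 1 ≤ c)
    (hq : 1 ≤ q) :
    ∫⁻ τ in Ioc (0 : ℝ) 1, ENNReal.ofReal (τ ^ (n - (k + 1)) * √(min (τ ^ n)⁻¹ (c * q))) ≤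
      ENNReal.ofReal ((√c + 2) * Real.exp 1 * kappa n (k + 1) q) := by
  have hq0 : 0 < q := by linarith
  have one_le_expκ : 1 ≤ Real.exp 1 * kappa n (k + 1) q :=
    one_le_mul_of_one_le_of_one_le (Real.one_le_exp zero_le_one) (one_le_kappa n (k + 1) hq)
  rw [mul_assoc]
  rcases Nat.lt_or_ge (2 * k) n with h | h
  · refine (setLIntegral_min_le_two (by omega) _).trans (ENNReal.ofReal_le_ofReal ?_)
    nlinarith [Real.sqrt_nonneg c]
  · set τ₀ : ℝ := q ^ (-(1 / n) : ℝ)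
    have τ₀_pos : 0 < τ₀ := Real.rpow_pos_of_pos hq0 _
    have τ₀_le : τ₀ ≤ 1 := Real.rpow_le_one_of_one_le_of_nonpos hq (neg_nonpos.2 (by positivity))
    have inner_le : ∫⁻ τ in Ioc (0 : ℝ) τ₀,
        ENNReal.ofReal (τ ^ (n - (k + 1)) * √(min (τ ^ n)⁻¹ (c * q))) ≤
          ENNReal.ofReal (√c * (Real.exp 1 * kappa n (k + 1) q)) := by
      refine (setLIntegral_Ioc_zero_min_le _ n τ₀_pos.le).trans (ENNReal.ofReal_le_ofReal ?_)
      rw [Real.sqrt_mul (by linarith), mul_left_comm, rpow_neg_inv_pow_mul_sqrt hk hq0]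
      gcongr
      exact rpow_le_exp_mul_kappa hk h hq
    have outer_le : ∫⁻ τ in Ioc τ₀ 1,
        ENNReal.ofReal (τ ^ (n - (k + 1)) * √(min (τ ^ n)⁻¹ (c * q))) ≤
          ENNReal.ofReal (2 * (Real.exp 1 * kappa n (k + 1) q)) := by
      refine le_trans (setLIntegral_mono' measurableSet_Ioc fun τ hτ =>
        ENNReal.ofReal_le_ofReal ?_) (setLIntegral_rpow_le_kappa hk h hq)
      refine (pow_mul_sqrt_min_inv_pow_le _ n (τ₀_pos.trans hτ.1) _).trans_eq ?_
      rw [Nat.cast_sub hk]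
      congr 1
      push_cast
      ring
    rw [← Ioc_union_Ioc_eq_Ioc τ₀_pos.le τ₀_le, add_mul,
      ENNReal.ofReal_add (by positivity) (by positivity)]
    exact (lintegral_union_le _ _ _).trans (add_le_add inner_le outer_le)

end MinIntegral

section PairingBound

open scoped FourierTransform ENNReal LineDeriv
open SchwartzMap

variable {V : Type*} [NormedAddCommGroup V] [InnerProductSpace ℝ V] [FiniteDimensional ℝ V]
  [MeasurableSpace V] [BorelSpace V]

local notation "d" => Module.finrank ℝ V

/-- The weight `(t - 1) ^ (n - ℓ) * t ^ (ℓ - 1)` in the kernel `G_ℓ`, for `ℓ = k + 1`. -/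
def dilationWeight (n k : ℕ) (t : ℝ) : ℝ := (t - 1) ^ (n - (k + 1)) * t ^ k

@[fun_prop]
theorem measurable_dilationWeight (n k : ℕ) : Measurable (dilationWeight n k) := by
  unfold dilationWeight
  fun_prop

theorem dilationWeight_nonneg (n k : ℕ) {t : ℝ} (ht : 1 < t) : 0 ≤ dilationWeight n k t := by
  have : 0 ≤ t - 1 := by linarith
  unfold dilationWeight
  positivity

theorem mul_dilationWeight_le_pow {n k : ℕ} (hk : k + 1 ≤ n) {t : ℝ} (ht : 1 < t) :
    t * dilationWeight n k t ≤ t ^ n := by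
  have : 0 ≤ t - 1 := by linarith
  calc t * dilationWeight n k t ≤ t * (t ^ (n - (k + 1)) * t ^ k) := by
        unfold dilationWeight
        gcongr
        linarith
    _ = t ^ n := by
        rw [← pow_add, ← pow_succ']
        congr 1
        omega

variable {k : ℕ} {M c q ρ : ℝ} {Ω : Set V} {g : V → ℝ} {v : V}

theorem dilationWeight_mul_enorm_pairing_le (hM : 0 ≤ M) (hc : 1 ≤ c) (hq : 1 ≤ q)
    (hΩ : MeasurableSet Ω) (η φ : 𝓢(V, ℝ)) (hη1 : ∫⁻ x, ‖∂_{v} η x‖ₑ ≤ ENNReal.ofReal M)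
    (hηΩ : ∀ x, ‖∂_{v} η x‖ₑ * volume Ω ≤ ENNReal.ofReal (M * (c * q)))
    (hg : Integrable g) (hgΩ : ∀ y ∉ Ω, g y = 0) {t : ℝ} (ht : t ∈ Ioc 1 2) :
    ENNReal.ofReal (dilationWeight d k t / t) * ‖pairing t η g (∂_{v} φ : 𝓢(V, ℝ))‖ₑ ≤
      ENNReal.ofReal (2 ^ k * M) * (eLpNorm g 2 volume * eLpNorm φ 2 volume) *
        ENNReal.ofReal ((t - 1) ^ (d - (k + 1)) * √(min ((t - 1) ^ d)⁻¹ (c * q))) := by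
  obtain ⟨ht1, ht2⟩ := ht
  have ht0 : 0 < t := by linarith
  have : 0 ≤ t - 1 := by linarith
  have hw := dilationWeight_nonneg d k ht1
  set N := eLpNorm g 2 volume * eLpNorm φ 2 volume
  set m := √(min ((t - 1) ^ d)⁻¹ (c * q))
  have weight_mul_le : dilationWeight d k t / t * (t * (M * m)) ≤
      2 ^ k * M * ((t - 1) ^ (d - (k + 1)) * m) := by
    calc dilationWeight d k t / t * (t * (M * m)) = t ^ k * M * ((t - 1) ^ (d - (k + 1)) * m) := by
          rw [dilationWeight]
          field_simp
      _ ≤ 2 ^ k * M * ((t - 1) ^ (d - (k + 1)) * m) := by gcongr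
  rw [pairing_lineDerivOp t η φ hg v, enorm_neg, enorm_mul, Real.enorm_of_nonneg ht0.le]
  calc ENNReal.ofReal (dilationWeight d k t / t) *
        (ENNReal.ofReal t * ‖pairing t (∂_{v} η : 𝓢(V, ℝ)) g φ‖ₑ)
      ≤ ENNReal.ofReal (dilationWeight d k t / t) *
          (ENNReal.ofReal t * (ENNReal.ofReal (M * m) * N)) := by
        gcongr
        exact enorm_pairing_le ht1 hΩ hM (by positivity) (SchwartzMap.continuous _) hη1 hηΩ
          hg.aestronglyMeasurable hgΩ φ.continuous.aestronglyMeasurable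
    _ = ENNReal.ofReal (dilationWeight d k t / t * (t * (M * m))) * N := by
        rw [← mul_assoc, ← mul_assoc, ← ENNReal.ofReal_mul (by positivity),
          ← ENNReal.ofReal_mul (by positivity), mul_assoc]
    _ ≤ ENNReal.ofReal (2 ^ k * M * ((t - 1) ^ (d - (k + 1)) * m)) * N := by gcongr
    _ = _ := by
        rw [ENNReal.ofReal_mul (by positivity), mul_right_comm]

theorem setLIntegral_Ioc_pairing_le (hk : k + 1 ≤ d) (hM : 0 ≤ M) (hc : 1 ≤ c) (hq : 1 ≤ q)
    (hΩ : MeasurableSet Ω) (η φ : 𝓢(V, ℝ)) (hη1 : ∫⁻ x, ‖∂_{v} η x‖ₑ ≤ ENNReal.ofReal M)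
    (hηΩ : ∀ x, ‖∂_{v} η x‖ₑ * volume Ω ≤ ENNReal.ofReal (M * (c * q)))
    (hg : Integrable g) (hgΩ : ∀ y ∉ Ω, g y = 0) :
    ∫⁻ t in Ioc (1 : ℝ) 2,
        ENNReal.ofReal (dilationWeight d k t / t) * ‖pairing t η g (∂_{v} φ : 𝓢(V, ℝ))‖ₑ ≤
      ENNReal.ofReal (2 ^ k * ((√c + 2) * Real.exp 1) * (M * kappa d (k + 1) q)) *
        (eLpNorm g 2 volume * eLpNorm φ 2 volume) := by
  set N := eLpNorm g 2 volume * eLpNorm φ 2 volume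
  let F (τ : ℝ) : ℝ≥0∞ :=
    ENNReal.ofReal (τ ^ (d - (k + 1)) * √(min (τ ^ d)⁻¹ (c * q)))
  have measurable_F : Measurable F := by fun_prop
  have preimage_Ioc : (fun t : ℝ => t - 1) ⁻¹' Ioc 0 1 = Ioc 1 2 := by
    rw [preimage_sub_const_Ioc, zero_add, one_add_one_eq_two]
  calc ∫⁻ t in Ioc (1 : ℝ) 2,
        ENNReal.ofReal (dilationWeight d k t / t) * ‖pairing t η g (∂_{v} φ : 𝓢(V, ℝ))‖ₑ
      ≤ ∫⁻ t in Ioc (1 : ℝ) 2, ENNReal.ofReal (2 ^ k * M) * N * F (t - 1) :=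
        setLIntegral_mono' measurableSet_Ioc fun t ht =>
          dilationWeight_mul_enorm_pairing_le hM hc hq hΩ η φ hη1 hηΩ hg hgΩ ht
    _ = ENNReal.ofReal (2 ^ k * M) * N * ∫⁻ τ in Ioc (0 : ℝ) 1, F τ := by
        rw [lintegral_const_mul _ (by fun_prop), ← preimage_Ioc,
          (measurePreserving_sub_right volume (1 : ℝ)).setLIntegral_comp_preimage
            measurableSet_Ioc measurable_F]
    _ ≤ ENNReal.ofReal (2 ^ k * M) * N *
        ENNReal.ofReal ((√c + 2) * Real.exp 1 * kappa d (k + 1) q) := by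
        gcongr
        exact setLIntegral_min_le_kappa hk hc hq
    _ = _ := by
        rw [mul_right_comm, ← ENNReal.ofReal_mul (by positivity)]
        congr 2
        ring

/-- The constant in the bound for `pairing` against a derivative; the first summand comes from the
dilations `t > 2` and the second one from `1 < t ≤ 2`. -/
def pairingConst (n k : ℕ) (c : ℝ) : ℝ :=
  2 ^ (n + 2) * Real.pi ^ 2 + 2 ^ k * ((√c + 2) * Real.exp 1)

theorem pairingConst_pos (n k : ℕ) (c : ℝ) : 0 < pairingConst n k c := by
  unfold pairingConst
  positivity

theorem setLIntegral_pairing_le (hk : k + 1 ≤ d) (hM : 0 ≤ M) (hρ : 0 < ρ) (hc : 1 ≤ c)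
    (hq : 1 ≤ q) (hΩ : MeasurableSet Ω) (η φ : 𝓢(V, ℝ))
    (hdecay : ∀ ξ, ‖𝓕 (fun x => (η x : ℂ)) ξ‖ ≤ M * ρ / (1 + ρ ^ 2 * ‖ξ‖ ^ 2))
    (hη1 : ∫⁻ x, ‖∂_{v} η x‖ₑ ≤ ENNReal.ofReal M)
    (hηΩ : ∀ x, ‖∂_{v} η x‖ₑ * volume Ω ≤ ENNReal.ofReal (M * (c * q)))
    (hg : Integrable g) (hg2 : MemLp g 2) (hgΩ : ∀ y ∉ Ω, g y = 0) (hv : ‖v‖ ≤ 1) :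
    ∫⁻ t in Ioi (1 : ℝ),
        ENNReal.ofReal (dilationWeight d k t / t) * ‖pairing t η g (∂_{v} φ : 𝓢(V, ℝ))‖ₑ ≤
      ENNReal.ofReal (pairingConst d k c * (M * kappa d (k + 1) q)) *
        (eLpNorm g 2 volume * eLpNorm φ 2 volume) := by
  have hκ := one_le_kappa d (k + 1) hq
  have weight_div_le {t : ℝ} (ht : 2 < t) : dilationWeight d k t / t ≤ t ^ d / t ^ 2 := by
    have : 0 < t := by linarith
    calc dilationWeight d k t / t = t * dilationWeight d k t / t ^ 2 := by field_simp
      _ ≤ t ^ d / t ^ 2 := by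
          gcongr
          exact mul_dilationWeight_le_pow hk (by linarith)
  have far : ∫⁻ t in Ioi (2 : ℝ),
      ENNReal.ofReal (dilationWeight d k t / t) * ‖pairing t η g (∂_{v} φ : 𝓢(V, ℝ))‖ₑ ≤
        ENNReal.ofReal (2 ^ (d + 2) * Real.pi ^ 2 * (M * kappa d (k + 1) q)) *
          (eLpNorm g 2 volume * eLpNorm φ 2 volume) := by
    refine (setLIntegral_mono' measurableSet_Ioi fun t ht =>
      mul_le_mul_left (ENNReal.ofReal_le_ofReal (weight_div_le ht)) _).trans <|
      (setLIntegral_Ioi_two_pairing_le (by positivity) hρ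
        η.continuous (norm_le_seminorm ℝ η) η.integrable hdecay hg hg2 φ hv).trans ?_
    gcongr
    rw [mul_div_cancel_right₀ _ hρ.ne']
    exact le_mul_of_one_le_right hM hκ
  rw [← Ioc_union_Ioi_eq_Ioi (one_le_two : (1 : ℝ) ≤ 2), pairingConst, add_mul, add_comm,
    ENNReal.ofReal_add (by positivity) (by positivity), add_mul]
  exact (lintegral_union_le _ _ _).trans
    (add_le_add (setLIntegral_Ioc_pairing_le hk hM hc hq hΩ η φ hη1 hηΩ hg hgΩ) far)

end PairingBound

section FourierDecay

open scoped FourierTransform LineDeriv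
open SchwartzMap

variable {V : Type*} [NormedAddCommGroup V] [InnerProductSpace ℝ V] [FiniteDimensional ℝ V]
  [MeasurableSpace V] [BorelSpace V]

theorem sq_inner_mul_norm_fourier_le (η : 𝓢(V, ℝ)) (v ξ : V) :
    inner ℝ ξ v ^ 2 * ‖𝓕 (fun x => (η x : ℂ)) ξ‖ ≤ ∫ x, |∂_{v} (∂_{v} η) x| := by
  have growth : (inner ℝ · v : V → ℝ).HasTemperateGrowth := by fun_prop
  have fourier_eq (ζ : 𝓢(V, ℝ)) : 𝓕 (fun x => (ζ x : ℂ)) ξ = 𝓕 (complexify ζ) ξ := by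
    rw [fourier_coe]
    rfl
  have norm_fourier_deriv : ‖𝓕 (fun x => ((∂_{v} (∂_{v} η) x : ℝ) : ℂ)) ξ‖ =
      (2 * Real.pi) ^ 2 * (inner ℝ ξ v ^ 2 * ‖𝓕 (fun x => (η x : ℂ)) ξ‖) := by
    rw [fourier_eq, fourier_eq, ← lineDerivOp_complexify, ← lineDerivOp_complexify,
      fourier_lineDerivOp_eq, fourier_lineDerivOp_eq]
    simp only [smul_apply, smulLeftCLM_apply_apply growth, norm_smul, norm_mul, Complex.norm_real,
      Complex.norm_I, Real.norm_eq_abs, abs_of_pos Real.pi_pos, RCLike.norm_ofNat, mul_one]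
    rw [← sq_abs (inner ℝ ξ v)]
    ring
  have one_le : 1 ≤ (2 * Real.pi) ^ 2 := one_le_pow₀ (by linarith [Real.pi_gt_three])
  calc inner ℝ ξ v ^ 2 * ‖𝓕 (fun x => (η x : ℂ)) ξ‖
      ≤ (2 * Real.pi) ^ 2 * (inner ℝ ξ v ^ 2 * ‖𝓕 (fun x => (η x : ℂ)) ξ‖) :=
        le_mul_of_one_le_left (by positivity) one_le
    _ ≤ ∫ x, ‖((∂_{v} (∂_{v} η) x : ℝ) : ℂ)‖ := by
        rw [← norm_fourier_deriv]
        exact norm_fourier_le_integral_norm _ ξ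
    _ = ∫ x, |∂_{v} (∂_{v} η) x| := by simp only [Complex.norm_real, Real.norm_eq_abs]

theorem norm_fourier_le_of_integral_le {ι : Type*} [Fintype ι] (b : OrthonormalBasis ι ℝ V)
    {η : 𝓢(V, ℝ)} {B ρ : ℝ} (h0 : ∫ x, |η x| ≤ B)
    (h2 : ∀ i, ρ ^ 2 * ∫ x, |∂_{b i} (∂_{b i} η) x| ≤ B) (ξ : V) :
    ‖𝓕 (fun x => (η x : ℂ)) ξ‖ ≤ (Fintype.card ι + 1) * B / (1 + ρ ^ 2 * ‖ξ‖ ^ 2) := by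
  set N := ‖𝓕 (fun x => (η x : ℂ)) ξ‖
  have order_zero : N ≤ B := by
    refine (norm_fourier_le_integral_norm _ ξ).trans ?_
    simpa only [Complex.norm_real, Real.norm_eq_abs] using h0
  have order_two (i : ι) : ρ ^ 2 * (inner ℝ ξ (b i) ^ 2 * N) ≤ B :=
    (mul_le_mul_of_nonneg_left (sq_inner_mul_norm_fourier_le η (b i) ξ) (sq_nonneg ρ)).trans (h2 i)
  rw [le_div_iff₀ (by positivity), ← b.sum_sq_norm_inner_left ξ]
  simp only [Real.norm_eq_abs, sq_abs]
  calc N * (1 + ρ ^ 2 * ∑ i, inner ℝ ξ (b i) ^ 2)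
      = N + ∑ i, ρ ^ 2 * (inner ℝ ξ (b i) ^ 2 * N) := by
        rw [← Finset.mul_sum, ← Finset.sum_mul]
        ring
    _ ≤ B + ∑ _i : ι, B := by
        gcongr with i
        exact order_two i
    _ = (Fintype.card ι + 1) * B := by
        simp only [Finset.sum_const, Finset.card_univ, nsmul_eq_mul]
        ring

end FourierDecay

section ScaledBounds

open scoped FourierTransform ENNReal LineDeriv
open SchwartzMap

variable {n k : ℕ}

/-- The bounds satisfied by a bump function of mass `B` living at scale `ρ`. Only the derivatives
`∂_j` and `∂_j ^ 2` are controlled, and the second ones only in `L¹`. -/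
structure HasScaledBounds (B ρ : ℝ) (η : 𝓢(E n, ℝ)) : Prop where
  integral_abs_le : ∫ x, |η x| ≤ B
  integral_abs_deriv_le (j : Fin n) : ∫ x, |∂_{(e j : E n)} η x| ≤ B / ρ
  integral_abs_deriv_deriv_le (j : Fin n) :
    ∫ x, |∂_{(e j : E n)} (∂_{(e j : E n)} η) x| ≤ B / ρ ^ 2
  abs_le (x : E n) : |η x| ≤ B / ρ ^ n
  abs_deriv_le (j : Fin n) (x : E n) : |∂_{(e j : E n)} η x| ≤ B / ρ ^ (n + 1)

theorem hasCompactSupport_of_tsupport_subset_closedBall {X : Type*} [PseudoMetricSpace X]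
    [ProperSpace X] {f : X → ℝ} {c : X} {r : ℝ} (h : tsupport f ⊆ Metric.closedBall c r) :
    HasCompactSupport f :=
  (isCompact_closedBall c r).of_isClosed_subset (isClosed_tsupport f) h

theorem HasScaledBounds.nonneg {B ρ : ℝ} {η : 𝓢(E n, ℝ)} (hη : HasScaledBounds B ρ η) : 0 ≤ B :=
  (integral_nonneg fun _ => abs_nonneg _).trans hη.integral_abs_le

theorem norm_e (j : Fin n) : ‖(e j : E n)‖ = 1 := by simp [e]

theorem HasScaledBounds.norm_fourier_le {B ρ : ℝ} {η : 𝓢(E n, ℝ)} (hη : HasScaledBounds B ρ η)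
    (hρ : 0 < ρ) (ξ : E n) :
    ‖𝓕 (fun x => (η x : ℂ)) ξ‖ ≤ (n + 1) * B / (1 + ρ ^ 2 * ‖ξ‖ ^ 2) := by
  have := norm_fourier_le_of_integral_le (EuclideanSpace.basisFun (Fin n) ℝ) (ρ := ρ)
    hη.integral_abs_le (fun j => ?_) ξ
  · simpa only [Fintype.card_fin] using this
  · rw [← le_div_iff₀' (by positivity), EuclideanSpace.basisFun_apply]
    exact hη.integral_abs_deriv_deriv_le j

theorem HasScaledBounds.setLIntegral_pairing_le {B ρ c q : ℝ} {η : 𝓢(E n, ℝ)}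
    (hη : HasScaledBounds B ρ η) (hk : k + 1 ≤ n) (hρ : 0 < ρ) (hc : 1 ≤ c) (hq : 1 ≤ q)
    {Ω : Set (E n)} (hΩ : MeasurableSet Ω) (hΩρ : volume Ω ≤ ENNReal.ofReal (c * q * ρ ^ n))
    {g : E n → ℝ} (hg : Integrable g) (hg2 : MemLp g 2) (hgΩ : ∀ y ∉ Ω, g y = 0)
    (φ : 𝓢(E n, ℝ)) (j : Fin n) :
    ∫⁻ t in Ioi (1 : ℝ), ENNReal.ofReal (dilationWeight n k t / t) *
        ‖pairing t η g (∂_{(e j : E n)} φ : 𝓢(E n, ℝ))‖ₑ ≤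
      ENNReal.ofReal (pairingConst n k c * ((n + 1) * B / ρ * kappa n (k + 1) q)) *
        (eLpNorm g 2 volume * eLpNorm φ 2 volume) := by
  have hB := hη.nonneg
  have finrank_eq : Module.finrank ℝ (E n) = n := finrank_euclideanSpace_fin
  have B_le : B ≤ (n + 1) * B := le_mul_of_one_le_left hB (by linarith [n.cast_nonneg (α := ℝ)])
  have lintegral_deriv : ∫⁻ x, ‖∂_{(e j : E n)} η x‖ₑ ≤ ENNReal.ofReal ((n + 1) * B / ρ) := by
    rw [← ofReal_integral_norm_eq_lintegral_enorm (SchwartzMap.integrable _)]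
    refine ENNReal.ofReal_le_ofReal ((hη.integral_abs_deriv_le j).trans ?_)
    gcongr
  have deriv_mul_volume (x : E n) :
      ‖∂_{(e j : E n)} η x‖ₑ * volume Ω ≤ ENNReal.ofReal ((n + 1) * B / ρ * (c * q)) := by
    calc ‖∂_{(e j : E n)} η x‖ₑ * volume Ω
        ≤ ENNReal.ofReal (B / ρ ^ (n + 1)) * ENNReal.ofReal (c * q * ρ ^ n) := by
          gcongr
          rw [Real.enorm_eq_ofReal_abs]
          exact ENNReal.ofReal_le_ofReal (hη.abs_deriv_le j x)
      _ = ENNReal.ofReal (B / ρ * (c * q)) := by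
          rw [← ENNReal.ofReal_mul (by positivity)]
          congr 1
          field_simp
          ring
      _ ≤ ENNReal.ofReal ((n + 1) * B / ρ * (c * q)) := by gcongr
  have := BogForms.setLIntegral_pairing_le (k := k) (by rwa [finrank_eq]) (by positivity) hρ hc hq
    hΩ η φ (fun ξ => ?_) lintegral_deriv deriv_mul_volume hg hg2 hgΩ (norm_e j).le
  · simpa only [finrank_eq] using this
  · rw [div_mul_cancel₀ _ hρ.ne']
    exact hη.norm_fourier_le hρ ξ

end ScaledBounds

section CoordMul

open scoped ENNReal LineDeriv
open SchwartzMap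

variable {n : ℕ}

/-- The `i`-th coordinate of `ℝⁿ` centred at `c`. -/
def coord (c : E n) (i : Fin n) (z : E n) : ℝ := (z - c) i

theorem hasTemperateGrowth_coord (c : E n) (i : Fin n) : (coord c i).HasTemperateGrowth := by
  have : coord c i = fun z => EuclideanSpace.proj (𝕜 := ℝ) i (z - c) := rfl
  rw [this]
  fun_prop

theorem abs_coord_le (c : E n) (i : Fin n) (z : E n) : |coord c i z| ≤ ‖z - c‖ :=
  PiLp.norm_apply_le (z - c) i

/-- Multiplication of a Schwartz function by a centred coordinate. -/
def coordMul (c : E n) (i : Fin n) (η : 𝓢(E n, ℝ)) : 𝓢(E n, ℝ) := smulLeftCLM ℝ (coord c i) η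

theorem coordMul_apply (c : E n) (i : Fin n) (η : 𝓢(E n, ℝ)) (z : E n) :
    coordMul c i η z = coord c i z * η z :=
  smulLeftCLM_apply_apply (hasTemperateGrowth_coord c i) η z

theorem lineDerivOp_coordMul (c : E n) (i j : Fin n) (η : 𝓢(E n, ℝ)) :
    ∂_{(e j : E n)} (coordMul c i η) =
      (if i = j then (1 : ℝ) else 0) • η + coordMul c i (∂_{(e j : E n)} η) := by
  ext z
  have deriv_coord : HasFDerivAt (coord c i) (EuclideanSpace.proj i : E n →L[ℝ] ℝ) z :=
    (EuclideanSpace.proj i : E n →L[ℝ] ℝ).hasFDerivAt.comp z ((hasFDerivAt_id z).sub_const c)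
  have coordMul_eq : ⇑(coordMul c i η) = coord c i * η := funext (coordMul_apply c i η)
  rw [lineDerivOp_apply_eq_fderiv, coordMul_eq, (deriv_coord.mul (η.hasFDerivAt z)).fderiv]
  split_ifs with hij <;>
    simp [coordMul_apply, lineDerivOp_apply_eq_fderiv, e, hij, add_comm, mul_comm]

theorem tsupport_lineDerivOp_subset (η : 𝓢(E n, ℝ)) (v : E n) :
    tsupport (∂_{v} η : 𝓢(E n, ℝ)) ⊆ tsupport η := by
  simpa only [← lineDerivOp_apply_eq_fderiv] using tsupport_fderiv_apply_subset ℝ v (f := η)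

theorem abs_coordMul_le {c : E n} {ρ : ℝ} {η : 𝓢(E n, ℝ)}
    (hη : tsupport η ⊆ Metric.closedBall c ρ) (i : Fin n) (z : E n) :
    |coordMul c i η z| ≤ ρ * |η z| := by
  rw [coordMul_apply, abs_mul]
  rcases eq_or_ne (η z) 0 with hz | hz
  · simp only [hz, abs_zero, mul_zero, le_refl]
  · gcongr
    exact (abs_coord_le c i z).trans (mem_closedBall_iff_norm.1 (hη (subset_tsupport η hz)))

theorem integral_abs_le_add {f g h : 𝓢(E n, ℝ)} {a b : ℝ}
    (hfgh : ∀ x, |h x| ≤ a * |f x| + b * |g x|) :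
    ∫ x, |h x| ≤ a * (∫ x, |f x|) + b * ∫ x, |g x| := by
  have integrable_abs (f : 𝓢(E n, ℝ)) : Integrable fun x => |f x| := f.integrable.abs
  rw [← integral_const_mul, ← integral_const_mul,
    ← integral_add ((integrable_abs f).const_mul a) ((integrable_abs g).const_mul b)]
  exact integral_mono (integrable_abs h)
    (((integrable_abs f).const_mul a).add ((integrable_abs g).const_mul b)) hfgh

variable {c : E n} {B ρ : ℝ} {η : 𝓢(E n, ℝ)}

theorem abs_lineDerivOp_coordMul_le (hη : tsupport η ⊆ Metric.closedBall c ρ) (i j : Fin n)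
    (z : E n) : |∂_{(e j : E n)} (coordMul c i η) z| ≤ 1 * |η z| + ρ * |∂_{(e j : E n)} η z| := by
  have delta_mul_le (x : ℝ) : |(if i = j then (1 : ℝ) else 0) * x| ≤ 1 * |x| := by
    split_ifs <;> simp
  rw [lineDerivOp_coordMul, add_apply, smul_apply, smul_eq_mul]
  exact (abs_add_le _ _).trans (add_le_add (delta_mul_le _)
    (abs_coordMul_le ((tsupport_lineDerivOp_subset η _).trans hη) i z))

theorem abs_lineDerivOp_lineDerivOp_coordMul_le (hη : tsupport η ⊆ Metric.closedBall c ρ)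
    (i j : Fin n) (z : E n) :
    |∂_{(e j : E n)} (∂_{(e j : E n)} (coordMul c i η)) z| ≤
      2 * |∂_{(e j : E n)} η z| + ρ * |∂_{(e j : E n)} (∂_{(e j : E n)} η) z| := by
  have delta_mul_le (x : ℝ) : |(if i = j then (1 : ℝ) else 0) * x| ≤ |x| := by
    split_ifs <;> simp
  have deriv_le := abs_lineDerivOp_coordMul_le
    ((tsupport_lineDerivOp_subset η (e j)).trans hη) i j z
  rw [lineDerivOp_coordMul, LineDeriv.lineDerivOp_add,
    LineDeriv.lineDerivOp_smul, add_apply, smul_apply, smul_eq_mul]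
  linarith [abs_add_le ((if i = j then (1 : ℝ) else 0) * ∂_{(e j : E n)} η z)
    (∂_{(e j : E n)} (coordMul c i (∂_{(e j : E n)} η)) z), delta_mul_le (∂_{(e j : E n)} η z)]

theorem HasScaledBounds.coordMul (hη : HasScaledBounds B ρ η) (hρ : 0 < ρ)
    (hsupp : tsupport η ⊆ Metric.closedBall c ρ) (i : Fin n) :
    HasScaledBounds (3 * ρ * B) ρ (coordMul c i η) := by
  have hB := hη.nonneg
  refine ⟨?_, fun j => ?_, fun j => ?_, fun x => ?_, fun j x => ?_⟩
  · calc ∫ x, |BogForms.coordMul c i η x| ≤ ρ * (∫ x, |η x|) + 0 * ∫ x, |η x| :=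
          integral_abs_le_add fun x => by simpa using abs_coordMul_le hsupp i x
      _ ≤ ρ * B + 0 * ∫ x, |η x| := by
          gcongr
          exact hη.integral_abs_le
      _ ≤ 3 * ρ * B := by linarith [mul_nonneg hρ.le hB]
  · calc _ ≤ 1 * (∫ x, |η x|) + ρ * ∫ x, |∂_{(e j : E n)} η x| :=
          integral_abs_le_add (abs_lineDerivOp_coordMul_le hsupp i j)
      _ ≤ 1 * B + ρ * (B / ρ) := by
          gcongr
          exacts [hη.integral_abs_le, hη.integral_abs_deriv_le j]
      _ = 2 * B := by
          field_simp
          ring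
      _ ≤ 3 * B := by linarith
      _ = 3 * ρ * B / ρ := by field_simp
  · calc _ ≤ 2 * (∫ x, |∂_{(e j : E n)} η x|) +
            ρ * ∫ x, |∂_{(e j : E n)} (∂_{(e j : E n)} η) x| :=
          integral_abs_le_add (abs_lineDerivOp_lineDerivOp_coordMul_le hsupp i j)
      _ ≤ 2 * (B / ρ) + ρ * (B / ρ ^ 2) := by
          gcongr
          exacts [hη.integral_abs_deriv_le j, hη.integral_abs_deriv_deriv_le j]
      _ = 3 * ρ * B / ρ ^ 2 := by
          field_simp
          ring
  · calc _ ≤ ρ * (B / ρ ^ n) :=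
          (abs_coordMul_le hsupp i x).trans (by gcongr; exact hη.abs_le x)
      _ ≤ 3 * (ρ * (B / ρ ^ n)) := le_mul_of_one_le_left (by positivity) (by norm_num)
      _ = 3 * ρ * B / ρ ^ n := by ring
  · calc _ ≤ 1 * (B / ρ ^ n) + ρ * (B / ρ ^ (n + 1)) :=
          (abs_lineDerivOp_coordMul_le hsupp i j x).trans (by
            gcongr
            exacts [hη.abs_le x, hη.abs_deriv_le j x])
      _ = 2 * (B / ρ ^ n) := by
          field_simp
          ring
      _ ≤ 3 * (B / ρ ^ n) := by
          gcongr
          norm_num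
      _ = 3 * ρ * B / ρ ^ (n + 1) := by
          field_simp
          ring

end CoordMul

section IsWeight

open scoped LineDeriv
open SchwartzMap

variable {n : ℕ}

/-- A positive common bound for the constants `K_α` of order at most two. -/
def weightConst (K : (k : ℕ) → (Fin k → Fin n) → ℝ) : ℝ :=
  1 + ∑ k ∈ Finset.range 3, ∑ J, |K k J|

theorem weightConst_pos (K : (k : ℕ) → (Fin k → Fin n) → ℝ) : 0 < weightConst K := by
  unfold weightConst
  positivity

theorem le_weightConst (K : (k : ℕ) → (Fin k → Fin n) → ℝ) {k : ℕ} (hk : k < 3)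
    (J : Fin k → Fin n) : K k J ≤ weightConst K :=
  calc K k J ≤ ∑ J, |K k J| :=
        (le_abs_self _).trans
          (Finset.single_le_sum (f := fun J => |K k J|) (fun _ _ => abs_nonneg _)
            (Finset.mem_univ J))
    _ ≤ ∑ k ∈ Finset.range 3, ∑ J, |K k J| :=
        Finset.single_le_sum (f := fun k => ∑ J, |K k J|)
          (fun _ _ => Finset.sum_nonneg fun _ _ => abs_nonneg _) (Finset.mem_range.2 hk)
    _ ≤ weightConst K := le_add_of_nonneg_left zero_le_one

theorem partialDeriv_zero (J : Fin 0 → Fin n) (θ : E n → ℝ) (x : E n) :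
    partialDeriv 0 J θ x = θ x :=
  iteratedFDeriv_zero_apply _

theorem partialDeriv_one (j : Fin n) (θ : 𝓢(E n, ℝ)) (x : E n) :
    partialDeriv 1 (fun _ => j) θ x = ∂_{(e j : E n)} θ x := by
  rw [partialDeriv, iteratedFDeriv_one_apply, lineDerivOp_apply_eq_fderiv]

theorem partialDeriv_two (j : Fin n) (θ : 𝓢(E n, ℝ)) (x : E n) :
    partialDeriv 2 (fun _ => j) θ x = ∂_{(e j : E n)} (∂_{(e j : E n)} θ) x := by
  have deriv_eq : ⇑(∂_{(e j : E n)} θ : 𝓢(E n, ℝ)) = fun z => fderiv ℝ θ z (e j) :=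
    funext (lineDerivOp_apply_eq_fderiv _ θ)
  have differentiableAt_fderiv : DifferentiableAt ℝ (fderiv ℝ θ) x :=
    ((θ.smooth 2).fderiv_right (m := 1) (by norm_num)).differentiable (by norm_num) x
  rw [partialDeriv, iteratedFDeriv_two_apply, lineDerivOp_apply_eq_fderiv, deriv_eq,
    fderiv_clm_apply differentiableAt_fderiv (differentiableAt_const _)]
  simp

variable {K : (k : ℕ) → (Fin k → Fin n) → ℝ} {c : E n} {r : ℝ}

theorem IsWeight.hasScaledBounds {θ : 𝓢(E n, ℝ)} (hθ : IsWeight K c r θ) :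
    HasScaledBounds (weightConst K) (Metric.diam (Metric.ball c r)) θ where
  integral_abs_le := by
    have := hθ.l1_bound 0 Fin.elim0
    simp only [partialDeriv_zero, pow_zero, div_one] at this
    exact this.trans (le_weightConst K (by norm_num) _)
  integral_abs_deriv_le j := by
    have := hθ.l1_bound 1 fun _ => j
    simp only [partialDeriv_one, pow_one] at this
    refine this.trans ?_
    gcongr
    exact le_weightConst K (by norm_num) _
  integral_abs_deriv_deriv_le j := by
    have := hθ.l1_bound 2 fun _ => j
    simp only [partialDeriv_two] at this
    refine this.trans ?_
    gcongr
    exact le_weightConst K (by norm_num) _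
  abs_le x := by
    have := hθ.sup_bound 0 Fin.elim0 x
    simp only [partialDeriv_zero, add_zero] at this
    refine this.trans ?_
    gcongr
    exact le_weightConst K (by norm_num) _
  abs_deriv_le j x := by
    have := hθ.sup_bound 1 (fun _ => j) x
    simp only [partialDeriv_one] at this
    refine this.trans ?_
    gcongr
    exact le_weightConst K (by norm_num) _

end IsWeight

section Young

open scoped ENNReal

variable {V : Type*} [NormedAddCommGroup V] [InnerProductSpace ℝ V] [FiniteDimensional ℝ V]
  [MeasurableSpace V] [BorelSpace V]

theorem lintegral_sq_convolution_le {κ f : V → ℝ≥0∞} (hκ : Measurable κ) (hf : AEMeasurable f) :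
    ∫⁻ x, (∫⁻ y, κ (x - y) * f y) ^ 2 ≤ (∫⁻ v, κ v) ^ 2 * ∫⁻ y, f y ^ 2 := by
  have aemeasurable_integrand : AEMeasurable fun p : V × V => κ (p.1 - p.2) * f p.2 ^ 2 :=
    (hκ.comp (by fun_prop)).aemeasurable.mul (hf.comp_snd.pow_const 2)
  have cauchy_schwarz (x : V) :
      (∫⁻ y, κ (x - y) * f y) ^ 2 ≤ (∫⁻ v, κ v) * ∫⁻ y, κ (x - y) * f y ^ 2 := by
    have := sq_lintegral_mul_mul_le (μ := (volume : Measure V)) (k := fun y => κ (x - y)) (f := f)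
      (g := 1) (hκ.comp (by fun_prop)).aemeasurable hf aemeasurable_const
    simp only [Pi.one_apply, mul_one, one_pow] at this
    rwa [lintegral_sub_left_eq_self κ x, mul_comm] at this
  calc ∫⁻ x, (∫⁻ y, κ (x - y) * f y) ^ 2
      ≤ ∫⁻ x, (∫⁻ v, κ v) * ∫⁻ y, κ (x - y) * f y ^ 2 := lintegral_mono cauchy_schwarz
    _ = (∫⁻ v, κ v) * ∫⁻ y, (∫⁻ x, κ (x - y)) * f y ^ 2 := by
        rw [lintegral_const_mul'' _ aemeasurable_integrand.lintegral_prod_right',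
          lintegral_lintegral_swap aemeasurable_integrand]
        congr 2
        funext y
        have measurable_shift : Measurable fun x => κ (x - y) := hκ.comp (by fun_prop)
        exact lintegral_mul_const (f y ^ 2) measurable_shift
    _ = (∫⁻ v, κ v) ^ 2 * ∫⁻ y, f y ^ 2 := by
        simp only [lintegral_sub_right_eq_self κ]
        rw [lintegral_const_mul'' _ (hf.pow_const 2)]
        ring

end Young

section AbsKernel

open scoped ENNReal

variable {V : Type*} [NormedAddCommGroup V] [InnerProductSpace ℝ V]

local notation "d" => Module.finrank ℝ V

/-- The integral over `t` defining `G_ℓ(x, y) (x - y)`, for a general weight `w`, with absolute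
values inside. -/
def absKernel (w : ℝ → ℝ) (θ : V → ℝ) (x y : V) : ℝ≥0∞ :=
  ∫⁻ t in Ioi (1 : ℝ), ‖w t * θ (y + t • (x - y))‖ₑ * ‖x - y‖ₑ

/-- An integrable function of `v = x - y` dominating `absKernel w θ x y` when `|θ| ≤ 1` and the
support of `θ` and the point `y` together stay within distance `D` of each other. -/
def kernelEnvelope (D : ℝ) (v : V) : ℝ≥0∞ :=
  ∫⁻ t in Ioi (1 : ℝ), ENNReal.ofReal (t ^ d / t ^ 2 * D) *
    (Metric.closedBall (0 : V) (D / t)).indicator 1 v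

variable {w : ℝ → ℝ} {θ g : V → ℝ}

theorem absKernel_le_kernelEnvelope (hw : ∀ t, 1 < t → t * |w t| ≤ t ^ d) {S D : ℝ}
    (hS : ∀ z, ‖θ z‖ ≤ S) {x y : V} (hD : ∀ z ∈ Function.support θ, ‖z - y‖ ≤ D) :
    absKernel w θ x y ≤ ENNReal.ofReal S * kernelEnvelope D (x - y) := by
  have hS0 : 0 ≤ S := (norm_nonneg _).trans (hS 0)
  unfold absKernel kernelEnvelope
  rw [← lintegral_const_mul' _ _ ENNReal.ofReal_ne_top]
  refine setLIntegral_mono' measurableSet_Ioi fun t (ht : 1 < t) => ?_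
  have ht0 : 0 < t := by linarith
  by_cases hz : θ (y + t • (x - y)) = 0
  · simp [hz]
  have norm_sub_le : ‖x - y‖ ≤ D / t := by
    have := hD _ hz
    rwa [add_sub_cancel_left, norm_smul, Real.norm_of_nonneg ht0.le, ← le_div_iff₀' ht0] at this
  rw [indicator_of_mem (mem_closedBall_zero_iff.2 norm_sub_le), Pi.one_apply, mul_one,
    ← ofReal_norm, ← ofReal_norm, ← ENNReal.ofReal_mul (by positivity), ← ENNReal.ofReal_mul hS0]
  refine ENNReal.ofReal_le_ofReal ?_
  calc ‖w t * θ (y + t • (x - y))‖ * ‖x - y‖ ≤ |w t| * S * (D / t) := by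
        rw [norm_mul, Real.norm_eq_abs (w t)]
        gcongr
        exact hS _
    _ = S * (t * |w t| / t ^ 2 * D) := by field_simp
    _ ≤ S * (t ^ d / t ^ 2 * D) := by
        have : 0 ≤ D := (norm_nonneg _).trans (hD _ hz)
        gcongr
        exact hw t ht

variable [MeasurableSpace V] [BorelSpace V]

theorem measurable_kernelEnvelope_integrand (D : ℝ) : Measurable fun p : V × ℝ =>
    ENNReal.ofReal (p.2 ^ d / p.2 ^ 2 * D) *
      (Metric.closedBall (0 : V) (D / p.2)).indicator (1 : V → ℝ≥0∞) p.1 := by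
  have measurableSet_le : MeasurableSet {p : V × ℝ | ‖p.1‖ ≤ D / p.2} :=
    measurableSet_le (by fun_prop) (by fun_prop)
  have indicator_eq : (fun p : V × ℝ => (Metric.closedBall (0 : V) (D / p.2)).indicator
      (1 : V → ℝ≥0∞) p.1) = {p : V × ℝ | ‖p.1‖ ≤ D / p.2}.indicator 1 := by
    funext p
    simp only [indicator, mem_closedBall_zero_iff, mem_ofPred_eq, Pi.one_apply]
  refine Measurable.mul (by fun_prop) ?_
  rw [indicator_eq]
  exact measurable_one.indicator measurableSet_le

theorem measurable_kernelEnvelope (D : ℝ) : Measurable (kernelEnvelope D : V → ℝ≥0∞) :=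
  (measurable_kernelEnvelope_integrand D).lintegral_prod_right'

variable [FiniteDimensional ℝ V]

theorem lintegral_kernelEnvelope_lt_top {D : ℝ} (hD : 0 ≤ D) :
    ∫⁻ v : V, kernelEnvelope D v < ⊤ := by
  have volume_ball_lt_top : volume (Metric.closedBall (0 : V) 1) < ⊤ := measure_closedBall_lt_top
  unfold kernelEnvelope
  rw [lintegral_lintegral_swap (measurable_kernelEnvelope_integrand D).aemeasurable]
  calc ∫⁻ t in Ioi (1 : ℝ), ∫⁻ v : V, ENNReal.ofReal (t ^ d / t ^ 2 * D) *
        (Metric.closedBall (0 : V) (D / t)).indicator 1 v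
      = ∫⁻ t in Ioi (1 : ℝ), ENNReal.ofReal (t ^ (-2 : ℝ)) * (ENNReal.ofReal (D ^ (d + 1)) *
          volume (Metric.closedBall (0 : V) 1)) := by
        refine setLIntegral_congr_fun measurableSet_Ioi fun t (ht : 1 < t) => ?_
        have ht0 : 0 < t := by linarith
        rw [lintegral_const_mul' _ _ ENNReal.ofReal_ne_top,
          lintegral_indicator_one Metric.isClosed_closedBall.measurableSet,
          Measure.addHaar_closedBall' volume _ (by positivity), ← mul_assoc, ← mul_assoc,
          ← ENNReal.ofReal_mul (by positivity), ← ENNReal.ofReal_mul (by positivity),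
          Real.rpow_neg ht0.le, Real.rpow_two]
        congr 2
        rw [div_pow]
        field_simp
        ring
    _ < ⊤ := by
        rw [lintegral_mul_const _ (by fun_prop)]
        exact ENNReal.mul_lt_top
          (integrableOn_Ioi_rpow_of_lt (by norm_num : (-2 : ℝ) < -1) one_pos).lintegral_lt_top
          (ENNReal.mul_lt_top ENNReal.ofReal_lt_top volume_ball_lt_top)

theorem measurable_absKernel (hw : Measurable w) (hθ : Measurable θ) :
    Measurable fun p : V × V => absKernel w θ p.1 p.2 := by
  have : Measurable fun q : (V × V) × ℝ =>
      ‖w q.2 * θ (q.1.2 + q.2 • (q.1.1 - q.1.2))‖ₑ * ‖q.1.1 - q.1.2‖ₑ := by fun_prop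
  exact this.lintegral_prod_right'

theorem lintegral_sq_absKernel_lt_top (hw : ∀ t, 1 < t → t * |w t| ≤ t ^ d)
    (hθ : Continuous θ) (hθc : HasCompactSupport θ) (hg : MemLp g 2)
    (hgs : Bornology.IsBounded (Function.support g)) :
    ∫⁻ x, (∫⁻ y, absKernel w θ x y * ‖g y‖ₑ) ^ 2 < ⊤ := by
  obtain ⟨S, hS⟩ := hθc.exists_bound_of_continuous hθ
  obtain ⟨a, ha⟩ := (hθc.isCompact.isBounded.subset (subset_tsupport θ)).exists_norm_le
  obtain ⟨b, hb⟩ := hgs.exists_norm_le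
  let D := max (a + b) 0
  have absKernel_mul_le (x y : V) :
      absKernel w θ x y * ‖g y‖ₑ ≤ ENNReal.ofReal S * kernelEnvelope D (x - y) * ‖g y‖ₑ := by
    rcases eq_or_ne (g y) 0 with hy | hy
    · simp only [hy, enorm_zero, mul_zero, le_refl]
    · gcongr
      exact absKernel_le_kernelEnvelope hw hS fun z hz =>
        ((norm_sub_le z y).trans (add_le_add (ha z hz) (hb y hy))).trans (le_max_left _ _)
  calc ∫⁻ x, (∫⁻ y, absKernel w θ x y * ‖g y‖ₑ) ^ 2
      ≤ ∫⁻ x, (∫⁻ y, ENNReal.ofReal S * kernelEnvelope D (x - y) * ‖g y‖ₑ) ^ 2 := by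
        gcongr ∫⁻ x, ?_ ^ 2 with x
        exact lintegral_mono (absKernel_mul_le x)
    _ ≤ (∫⁻ v : V, ENNReal.ofReal S * kernelEnvelope D v) ^ 2 * eLpNorm g 2 volume ^ 2 := by
        rw [eLpNorm_two_sq]
        exact lintegral_sq_convolution_le ((measurable_kernelEnvelope D).const_mul _) hg.1.enorm
    _ < ⊤ := by
        rw [lintegral_const_mul _ (measurable_kernelEnvelope D)]
        exact ENNReal.mul_lt_top (ENNReal.pow_lt_top (ENNReal.mul_lt_top ENNReal.ofReal_lt_top
          (lintegral_kernelEnvelope_lt_top (le_max_right _ _)))) (ENNReal.pow_lt_top hg.2)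

end AbsKernel

section ScalarOperator

open scoped ENNReal

variable {n k : ℕ} {θ g D : E n → ℝ}

/-- The scalar operator with kernel `G_ℓ(x, y) (x - y)_i`, for `ℓ = k + 1`. The coefficients of
`B_ℓ u` are sums of such operators applied to components of `u`. -/
def bogScalar (k : ℕ) (θ : E n → ℝ) (i : Fin n) (g : E n → ℝ) (x : E n) : ℝ :=
  ∫ y, kernelG (k + 1) θ x y * (x - y) i * g y

theorem enorm_apply_le (z : E n) (i : Fin n) : ‖z i‖ₑ ≤ ‖z‖ₑ :=
  enorm_le_iff_norm_le.2 (PiLp.norm_apply_le z i)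

theorem mul_abs_dilationWeight_le_pow (hk : k + 1 ≤ n) {t : ℝ} (ht : 1 < t) :
    t * |dilationWeight n k t| ≤ t ^ Module.finrank ℝ (E n) := by
  rw [abs_of_nonneg (dilationWeight_nonneg n k ht), finrank_euclideanSpace_fin]
  exact mul_dilationWeight_le_pow hk ht

theorem enorm_kernelG_mul_le (k : ℕ) (θ : E n → ℝ) (x y : E n) (i : Fin n) :
    ‖kernelG (k + 1) θ x y * (x - y) i‖ₑ ≤ absKernel (dilationWeight n k) θ x y := by
  rw [absKernel, lintegral_mul_const' _ _ enorm_ne_top, enorm_mul]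
  gcongr
  · exact enorm_integral_le_lintegral_enorm _
  · exact enorm_apply_le (x - y) i

theorem aestronglyMeasurable_kernelG_mul (hθ : Continuous θ) (hg : AEStronglyMeasurable g)
    (i : Fin n) :
    AEStronglyMeasurable fun p : E n × E n =>
      kernelG (k + 1) θ p.1 p.2 * (p.1 - p.2) i * g p.2 := by
  have continuous_integrand : Continuous fun q : (E n × E n) × ℝ =>
      (q.2 - 1) ^ (n - (k + 1)) * q.2 ^ k * θ (q.1.2 + q.2 • (q.1.1 - q.1.2)) := by
    fun_prop
  have continuous_coord : Continuous fun p : E n × E n => (p.1 - p.2) i := by fun_prop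
  exact (continuous_integrand.stronglyMeasurable.integral_prod_right'.aestronglyMeasurable.mul
    continuous_coord.aestronglyMeasurable).mul hg.comp_snd

variable (hk : k + 1 ≤ n) (hθ : Continuous θ) (hθc : HasCompactSupport θ) (hg : MemLp g 2)
  (hgs : Bornology.IsBounded (Function.support g))
include hk hθ hθc hg hgs

theorem lintegral_sq_absKernel_dilationWeight_lt_top :
    ∫⁻ x, (∫⁻ y, absKernel (dilationWeight n k) θ x y * ‖g y‖ₑ) ^ 2 < ⊤ :=
  lintegral_sq_absKernel_lt_top (fun _ => mul_abs_dilationWeight_le_pow hk) hθ hθc hg hgs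

theorem ae_integrable_kernelG_mul (i : Fin n) :
    ∀ᵐ x, Integrable fun y => kernelG (k + 1) θ x y * (x - y) i * g y := by
  have aemeasurable_sq : AEMeasurable fun x =>
      (∫⁻ y, absKernel (dilationWeight n k) θ x y * ‖g y‖ₑ) ^ 2 :=
    ((measurable_absKernel (by fun_prop) hθ.measurable).aemeasurable.mul
      hg.1.enorm.comp_snd).lintegral_prod_right'.pow_const 2
  filter_upwards [ae_lt_top' aemeasurable_sq
      (lintegral_sq_absKernel_dilationWeight_lt_top hk hθ hθc hg hgs).ne,
    (aestronglyMeasurable_kernelG_mul (k := k) hθ hg.1 i).prodMk_left] with x hx hmeas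
  refine ⟨hmeas, ?_⟩
  calc ∫⁻ y, ‖kernelG (k + 1) θ x y * (x - y) i * g y‖ₑ
      ≤ ∫⁻ y, absKernel (dilationWeight n k) θ x y * ‖g y‖ₑ := by
        gcongr with y
        rw [enorm_mul]
        gcongr
        exact enorm_kernelG_mul_le k θ x y i
    _ < ⊤ := (ENNReal.pow_lt_top_iff.1 hx).resolve_right two_ne_zero

theorem memLp_bogScalar (i : Fin n) : MemLp (bogScalar k θ i g) 2 := by
  refine ⟨(aestronglyMeasurable_kernelG_mul hθ hg.1 i).integral_prod_right',
    (ENNReal.pow_lt_top_iff.1 ?_).resolve_right two_ne_zero⟩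
  rw [eLpNorm_two_sq]
  refine lt_of_le_of_lt (lintegral_mono fun x => ?_)
    (lintegral_sq_absKernel_dilationWeight_lt_top hk hθ hθc hg hgs)
  gcongr
  refine (enorm_integral_le_lintegral_enorm _).trans (lintegral_mono fun y => ?_)
  rw [enorm_mul]
  gcongr
  exact enorm_kernelG_mul_le k θ x y i

theorem lintegral_mul_absKernel_lt_top (hD : MemLp D 2) :
    ∫⁻ x, ‖D x‖ₑ * ∫⁻ y, absKernel (dilationWeight n k) θ x y * ‖g y‖ₑ < ⊤ := by
  have mul_le_add_sq (a b : ℝ≥0∞) : a * b ≤ a ^ 2 + b ^ 2 := by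
    rcases le_total a b with hab | hab
    · exact (mul_le_mul_left hab b).trans (by rw [← sq]; exact le_add_self)
    · exact (mul_le_mul_right hab a).trans (by rw [← sq]; exact le_self_add)
  refine (lintegral_mono fun x => mul_le_add_sq _ _).trans_lt ?_
  rw [lintegral_add_left' (hD.1.enorm.pow_const 2), ← eLpNorm_two_sq]
  exact ENNReal.add_lt_top.2 ⟨ENNReal.pow_lt_top hD.2,
    lintegral_sq_absKernel_dilationWeight_lt_top hk hθ hθc hg hgs⟩

theorem integrable_dilationWeight_mul (hD : MemLp D 2) (i : Fin n) :
    Integrable (fun q : (E n × E n) × ℝ =>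
      dilationWeight n k q.2 * θ (q.1.2 + q.2 • (q.1.1 - q.1.2)) *
        ((q.1.1 - q.1.2) i * (D q.1.1 * g q.1.2)))
      (volume.prod (volume.restrict (Ioi (1 : ℝ)))) := by
  have aestronglyMeasurable_integrand : AEStronglyMeasurable (fun q : (E n × E n) × ℝ =>
      dilationWeight n k q.2 * θ (q.1.2 + q.2 • (q.1.1 - q.1.2)) *
        ((q.1.1 - q.1.2) i * (D q.1.1 * g q.1.2)))
      (volume.prod (volume.restrict (Ioi (1 : ℝ)))) := by
    have : Continuous (dilationWeight n k) := by
      unfold dilationWeight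
      fun_prop
    refine AEStronglyMeasurable.mul (Continuous.aestronglyMeasurable (by fun_prop))
      (AEStronglyMeasurable.mul (Continuous.aestronglyMeasurable (by fun_prop)) ?_)
    exact (hD.1.comp_fst.mul hg.1.comp_snd).comp_fst
  refine ⟨aestronglyMeasurable_integrand, ?_⟩
  rw [HasFiniteIntegral, lintegral_prod _ aestronglyMeasurable_integrand.enorm]
  calc ∫⁻ p : E n × E n, ∫⁻ t in Ioi (1 : ℝ),
        ‖dilationWeight n k t * θ (p.2 + t • (p.1 - p.2)) * ((p.1 - p.2) i * (D p.1 * g p.2))‖ₑ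
      ≤ ∫⁻ p : E n × E n, ‖D p.1‖ₑ * (absKernel (dilationWeight n k) θ p.1 p.2 * ‖g p.2‖ₑ) := by
        gcongr with p
        rw [absKernel, mul_left_comm ‖D p.1‖ₑ, ← lintegral_mul_const' _ _
          (ENNReal.mul_ne_top enorm_ne_top enorm_ne_top)]
        gcongr with t
        rw [enorm_mul, enorm_mul ((p.1 - p.2) i), enorm_mul (D p.1), ← mul_assoc]
        gcongr
        exact enorm_apply_le (p.1 - p.2) i
    _ = ∫⁻ x, ‖D x‖ₑ * ∫⁻ y, absKernel (dilationWeight n k) θ x y * ‖g y‖ₑ := by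
        rw [Measure.volume_eq_prod, lintegral_prod _ (by
          exact hD.1.enorm.comp_fst.mul ((measurable_absKernel (by fun_prop)
            hθ.measurable).aemeasurable.mul hg.1.enorm.comp_snd))]
        simp only [lintegral_const_mul' _ _ enorm_ne_top]
    _ < ⊤ := lintegral_mul_absKernel_lt_top hk hθ hθc hg hgs hD

end ScalarOperator

section PairingRepresentation

open scoped ENNReal
open SchwartzMap

theorem integrable_of_isBounded_support {V : Type*} [NormedAddCommGroup V]
    [InnerProductSpace ℝ V] [FiniteDimensional ℝ V] [MeasurableSpace V] [BorelSpace V] {g : V → ℝ}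
    (hg : MemLp g 2) (hgs : Bornology.IsBounded (Function.support g)) : Integrable g := by
  obtain ⟨b, hb⟩ := hgs.subset_closedBall 0
  have : IsFiniteMeasure (volume.restrict (Metric.closedBall (0 : V) b)) :=
    ⟨by simpa using measure_closedBall_lt_top⟩
  rw [← integrableOn_iff_integrable_of_support_subset hb]
  exact hg.restrict _ |>.integrable one_le_two

theorem aestronglyMeasurable_pairing {V : Type*} [NormedAddCommGroup V] [InnerProductSpace ℝ V]
    [FiniteDimensional ℝ V] [MeasurableSpace V] [BorelSpace V] {η g D : V → ℝ} (hη : Continuous η)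
    (hg : AEStronglyMeasurable g) (hD : AEStronglyMeasurable D) (μ : Measure ℝ) [SFinite μ] :
    AEStronglyMeasurable (fun t => pairing t η g D) μ := by
  have aestronglyMeasurable_integrand : AEStronglyMeasurable (fun q : ℝ × (V × V) =>
      η (q.2.2 + q.1 • (q.2.1 - q.2.2)) * (D q.2.1 * g q.2.2)) (μ.prod volume) :=
    (Continuous.aestronglyMeasurable (by fun_prop)).mul
      (hD.comp_fst.mul hg.comp_snd : AEStronglyMeasurable fun p : V × V => D p.1 * g p.2).comp_snd
  exact aestronglyMeasurable_integrand.integral_prod_right'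

variable {n k : ℕ} {c : E n} {R : ℝ} {θ : 𝓢(E n, ℝ)} {g D : E n → ℝ}

theorem norm_coord_mul_le (hgs : ∀ y ∈ Function.support g, ‖y - c‖ ≤ R) (i : Fin n) (y : E n) :
    ‖(coord c i * g) y‖ ≤ R * ‖g y‖ := by
  by_cases hy : g y = 0
  · simp [hy]
  · rw [Pi.mul_apply, norm_mul]
    gcongr
    exact (abs_coord_le c i y).trans (hgs y hy)

theorem continuous_coord (c : E n) (i : Fin n) : Continuous (coord c i) :=
  (hasTemperateGrowth_coord c i).1.continuous

theorem integrable_coord_mul (hg : Integrable g)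
    (hgs : ∀ y ∈ Function.support g, ‖y - c‖ ≤ R) (i : Fin n) : Integrable (coord c i * g) :=
  (hg.norm.const_mul R).mono' ((continuous_coord c i).aestronglyMeasurable.mul hg.1)
    (.of_forall (norm_coord_mul_le hgs i))

theorem eLpNorm_coord_mul_le (hgs : ∀ y ∈ Function.support g, ‖y - c‖ ≤ R) (i : Fin n) :
    eLpNorm (coord c i * g) 2 volume ≤ ENNReal.ofReal R * eLpNorm g 2 volume :=
  eLpNorm_le_mul_eLpNorm_of_ae_le_mul (.of_forall (norm_coord_mul_le hgs i)) 2

theorem isBounded_support_of_norm_sub_le (hgs : ∀ y ∈ Function.support g, ‖y - c‖ ≤ R) :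
    Bornology.IsBounded (Function.support g) :=
  Metric.isBounded_closedBall.subset fun y hy => mem_closedBall_iff_norm.2 (hgs y hy)

theorem integral_dilate_coord_mul {t : ℝ} (ht : t ≠ 0) (hg : Integrable g)
    (hgs : ∀ y ∈ Function.support g, ‖y - c‖ ≤ R) (hD : Integrable D) (i : Fin n) :
    ∫ p : E n × E n, θ (p.2 + t • (p.1 - p.2)) * ((p.1 - p.2) i * (D p.1 * g p.2)) =
      t⁻¹ * (pairing t (coordMul c i θ) g D - pairing t θ (coord c i * g) D) := by
  have bound (η : 𝓢(E n, ℝ)) : ∀ x, ‖η x‖ ≤ _ := norm_le_seminorm ℝ η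
  rw [pairing, pairing, ← integral_sub
    (integrable_pairing (coordMul c i θ).continuous (bound _) hg hD)
    (integrable_pairing θ.continuous (bound _) (integrable_coord_mul hg hgs i) hD),
    ← integral_const_mul]
  refine integral_congr_ae (.of_forall fun p => ?_)
  have coord_sub : (p.1 - p.2) i =
      t⁻¹ * (coord c i (p.2 + t • (p.1 - p.2)) - coord c i p.2) := by
    simp only [coord, PiLp.sub_apply, PiLp.add_apply, PiLp.smul_apply, smul_eq_mul]
    field_simp
    ring
  simp only [coordMul_apply, Pi.mul_apply, coord_sub]
  ring

theorem integral_bogScalar_mul (hk : k + 1 ≤ n) (hθ : HasCompactSupport θ) (hg : MemLp g 2)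
    (hgs : ∀ y ∈ Function.support g, ‖y - c‖ ≤ R) (hD : MemLp D 2) (hDi : Integrable D)
    (i : Fin n) :
    ∫ x, bogScalar k θ i g x * D x = ∫ t in Ioi (1 : ℝ), dilationWeight n k t / t *
      (pairing t (coordMul c i θ) g D - pairing t θ (coord c i * g) D) := by
  have bounded := isBounded_support_of_norm_sub_le hgs
  have integrable_triple :=
    integrable_dilationWeight_mul hk θ.continuous hθ hg bounded hD i
  calc ∫ x, bogScalar k θ i g x * D x
      = ∫ x, ∫ y, ∫ t in Ioi (1 : ℝ), dilationWeight n k t * θ (y + t • (x - y)) *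
          ((x - y) i * (D x * g y)) := by
        refine integral_congr_ae (.of_forall fun x => ?_)
        simp only [bogScalar, ← integral_mul_const (D x)]
        refine integral_congr_ae (.of_forall fun y => ?_)
        simp only [integral_mul_const, kernelG, dilationWeight, Nat.add_sub_cancel]
        ring
    _ = ∫ p : E n × E n, ∫ t in Ioi (1 : ℝ), dilationWeight n k t *
          θ (p.2 + t • (p.1 - p.2)) * ((p.1 - p.2) i * (D p.1 * g p.2)) := by
        rw [Measure.volume_eq_prod, integral_prod]
        exact integrable_triple.integral_prod_left
    _ = ∫ t in Ioi (1 : ℝ), ∫ p : E n × E n, dilationWeight n k t *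
          θ (p.2 + t • (p.1 - p.2)) * ((p.1 - p.2) i * (D p.1 * g p.2)) :=
        integral_integral_swap integrable_triple
    _ = ∫ t in Ioi (1 : ℝ), dilationWeight n k t / t *
          (pairing t (coordMul c i θ) g D - pairing t θ (coord c i * g) D) := by
        refine setIntegral_congr_fun measurableSet_Ioi fun t (ht : 1 < t) => ?_
        simp only [mul_assoc (dilationWeight n k t), integral_const_mul, div_eq_mul_inv]
        rw [integral_dilate_coord_mul (by linarith)
          (integrable_of_isBounded_support hg bounded) hgs hDi]

theorem enorm_integral_bogScalar_mul_le (hk : k + 1 ≤ n) (hθ : HasCompactSupport θ)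
    (hg : MemLp g 2) (hgs : ∀ y ∈ Function.support g, ‖y - c‖ ≤ R) (hD : MemLp D 2)
    (hDi : Integrable D) (i : Fin n) :
    ‖∫ x, bogScalar k θ i g x * D x‖ₑ ≤
      (∫⁻ t in Ioi (1 : ℝ), ENNReal.ofReal (dilationWeight n k t / t) *
        ‖pairing t (coordMul c i θ) g D‖ₑ) +
      ∫⁻ t in Ioi (1 : ℝ), ENNReal.ofReal (dilationWeight n k t / t) *
        ‖pairing t θ (coord c i * g) D‖ₑ := by
  have aemeasurable_left : AEMeasurable (fun t => ENNReal.ofReal (dilationWeight n k t / t) *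
      ‖pairing t (coordMul c i θ) g D‖ₑ) (volume.restrict (Ioi 1)) :=
    AEMeasurable.mul (by fun_prop)
      (aestronglyMeasurable_pairing (coordMul c i θ).continuous hg.1 hD.1 _).enorm
  rw [integral_bogScalar_mul hk hθ hg hgs hD hDi, ← lintegral_add_left' aemeasurable_left]
  refine (enorm_integral_le_lintegral_enorm _).trans
    (setLIntegral_mono' measurableSet_Ioi fun t (ht : 1 < t) => ?_)
  rw [enorm_mul, Real.enorm_of_nonneg
    (div_nonneg (dilationWeight_nonneg n k ht) (zero_le_one.trans ht.le)), ← mul_add]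
  gcongr
  exact enorm_sub_le

end PairingRepresentation

section ScalarBound

open scoped ENNReal LineDeriv
open SchwartzMap

variable {n k : ℕ} {c : E n} {r A ρ R a q : ℝ} {Ω : Set (E n)} {θ : 𝓢(E n, ℝ)} {g : E n → ℝ}

theorem enorm_integral_bogScalar_mul_lineDerivOp_le (hk : k + 1 ≤ n) (hρ : 0 < ρ) (hρR : ρ ≤ R)
    (ha : 1 ≤ a) (hq : 1 ≤ q) (hθ : HasScaledBounds A ρ θ)
    (hsupp : tsupport θ ⊆ Metric.closedBall c ρ) (hΩ : MeasurableSet Ω)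
    (hΩρ : volume Ω ≤ ENNReal.ofReal (a * q * ρ ^ n)) (hg : MemLp g 2)
    (hgs : ∀ y ∈ Function.support g, ‖y - c‖ ≤ R) (hgΩ : ∀ y ∉ Ω, g y = 0)
    (φ : 𝓢(E n, ℝ)) (i j : Fin n) :
    ‖∫ x, bogScalar k θ i g x * ∂_{(e j : E n)} φ x‖ₑ ≤
      ENNReal.ofReal (4 * (n + 1) * pairingConst n k a * A * (R / ρ) * kappa n (k + 1) q) *
        (eLpNorm g 2 volume * eLpNorm φ 2 volume) := by
  have integrable_g : Integrable g :=
    integrable_of_isBounded_support hg (isBounded_support_of_norm_sub_le hgs)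
  have integrable_coord_g := integrable_coord_mul integrable_g hgs i
  have eLpNorm_coord_g := eLpNorm_coord_mul_le hgs i
  have memLp_coord_g : MemLp (coord c i * g) 2 := ⟨integrable_coord_g.1,
    eLpNorm_coord_g.trans_lt (ENNReal.mul_lt_top ENNReal.ofReal_lt_top hg.2)⟩
  have bound_coordMul := (hθ.coordMul hρ hsupp i).setLIntegral_pairing_le hk hρ ha hq hΩ hΩρ
    integrable_g hg hgΩ φ j
  have bound_coord_g := hθ.setLIntegral_pairing_le hk hρ ha hq hΩ hΩρ
    integrable_coord_g memLp_coord_g (fun y hy => by simp [hgΩ y hy]) φ j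
  have hP := pairingConst_pos n k a
  have hκ := one_le_kappa n (k + 1) hq
  have hA := hθ.nonneg
  have hR : 0 ≤ R := hρ.le.trans hρR
  have one_le_ratio : 1 ≤ R / ρ := (one_le_div hρ).2 hρR
  set κ := kappa n (k + 1) q
  calc ‖∫ x, bogScalar k θ i g x * ∂_{(e j : E n)} φ x‖ₑ
      ≤ ENNReal.ofReal (pairingConst n k a * ((n + 1) * (3 * ρ * A) / ρ * κ)) *
          (eLpNorm g 2 volume * eLpNorm φ 2 volume) +
        ENNReal.ofReal (pairingConst n k a * ((n + 1) * A / ρ * κ)) *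
          (ENNReal.ofReal R * eLpNorm g 2 volume * eLpNorm φ 2 volume) := by
        refine (enorm_integral_bogScalar_mul_le hk
          (hasCompactSupport_of_tsupport_subset_closedBall hsupp) hg hgs
          ((∂_{(e j : E n)} φ : 𝓢(E n, ℝ)).memLp 2 volume)
          (∂_{(e j : E n)} φ : 𝓢(E n, ℝ)).integrable i).trans
          (add_le_add bound_coordMul (bound_coord_g.trans (by gcongr)))
    _ = ENNReal.ofReal ((n + 1) * pairingConst n k a * A * κ * (3 + R / ρ)) *
          (eLpNorm g 2 volume * eLpNorm φ 2 volume) := by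
        rw [mul_assoc (ENNReal.ofReal R), ← mul_assoc (ENNReal.ofReal _) (ENNReal.ofReal R),
          ← add_mul, ← ENNReal.ofReal_mul (by positivity),
          ← ENNReal.ofReal_add (by positivity) (by positivity)]
        congr 2
        field_simp
    _ ≤ ENNReal.ofReal (4 * (n + 1) * pairingConst n k a * A * (R / ρ) * κ) *
          (eLpNorm g 2 volume * eLpNorm φ 2 volume) := by
        refine mul_le_mul_left (ENNReal.ofReal_le_ofReal ?_) _
        calc (n + 1) * pairingConst n k a * A * κ * (3 + R / ρ)
            ≤ (n + 1) * pairingConst n k a * A * κ * (4 * (R / ρ)) := by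
              gcongr
              linarith
          _ = 4 * (n + 1) * pairingConst n k a * A * (R / ρ) * κ := by ring

/-- A constant `a ≥ 1` for which `|Ω| ≤ a (|Ω| / |B|) diam(B)^n` whenever `B` is a ball. -/
def ballConst (n : ℕ) : ℝ := max 1 (volume.real (Metric.ball (0 : E n) 1))

theorem one_le_volume_ratio (hr : 0 < r) (hball : Metric.ball c r ⊆ Ω) (hΩ : volume Ω ≠ ⊤) :
    1 ≤ volume.real Ω / volume.real (Metric.ball c r) := by
  have volume_ball_pos : 0 < volume.real (Metric.ball c r) :=
    ENNReal.toReal_pos (Metric.measure_ball_pos volume c hr).ne' measure_ball_lt_top.ne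
  exact (one_le_div volume_ball_pos).2 (measureReal_mono hball hΩ)

theorem volume_le_ballConst_mul (c : E n) (hr : 0 < r) (hΩ : volume Ω ≠ ⊤) :
    volume Ω ≤ ENNReal.ofReal (ballConst n *
      (volume.real Ω / volume.real (Metric.ball c r)) * (2 * r) ^ n) := by
  have volume_ball : volume.real (Metric.ball c r) =
      r ^ n * volume.real (Metric.ball (0 : E n) 1) := by
    rw [measureReal_def, Measure.addHaar_ball_of_pos volume c hr, ENNReal.toReal_mul,
      ENNReal.toReal_ofReal (by positivity), finrank_euclideanSpace_fin, measureReal_def]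
  have unit_ball_pos : 0 < volume.real (Metric.ball (0 : E n) 1) :=
    ENNReal.toReal_pos (Metric.measure_ball_pos volume 0 one_pos).ne' measure_ball_lt_top.ne
  rw [← ofReal_measureReal hΩ, volume_ball]
  refine ENNReal.ofReal_le_ofReal ?_
  calc volume.real Ω = volume.real (Metric.ball (0 : E n) 1) *
        (volume.real Ω / (r ^ n * volume.real (Metric.ball (0 : E n) 1))) * r ^ n := by
        field_simp
    _ ≤ ballConst n * (volume.real Ω / (r ^ n * volume.real (Metric.ball (0 : E n) 1))) *
        (2 * r) ^ n := by
        have unit_ball_le : volume.real (Metric.ball (0 : E n) 1) ≤ ballConst n :=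
          le_max_right _ _
        have := unit_ball_pos.trans_le unit_ball_le
        gcongr
        linarith

end ScalarBound

section WeakDerivative

open scoped ENNReal LineDeriv
open SchwartzMap

theorem integral_sq_eq_toReal_eLpNorm_sq {α : Type*} [MeasurableSpace α] {μ : Measure α}
    {f : α → ℝ} (hf : AEStronglyMeasurable f μ) :
    ∫ x, f x ^ 2 ∂μ = (eLpNorm f 2 μ).toReal ^ 2 := by
  rw [← ENNReal.toReal_pow, eLpNorm_two_sq,
    integral_eq_lintegral_of_nonneg_ae (.of_forall fun x => sq_nonneg _) (hf.pow 2)]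
  simp only [← enorm_pow, Real.enorm_of_nonneg (sq_nonneg _)]

section

variable {V : Type*} [NormedAddCommGroup V] [InnerProductSpace ℝ V] [FiniteDimensional ℝ V]
  [MeasurableSpace V] [BorelSpace V]

theorem exists_memLp_integral_mul_eq (Λ : 𝓢(V, ℝ) →ₗ[ℝ] ℝ) {M : ℝ} (hM : 0 ≤ M)
    (hΛ : ∀ φ, ‖Λ φ‖ₑ ≤ ENNReal.ofReal M * eLpNorm φ 2 volume) :
    ∃ G : V → ℝ, MemLp G 2 ∧ eLpNorm G 2 volume ≤ ENNReal.ofReal M ∧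
      ∀ φ, Λ φ = ∫ x, G x * φ x := by
  let ι : 𝓢(V, ℝ) →ₗ[ℝ] Lp ℝ 2 (volume : Measure V) :=
    (toLpCLM ℝ ℝ 2 volume : 𝓢(V, ℝ) →L[ℝ] Lp ℝ 2 (volume : Measure V))
  have denseRange_ι : DenseRange ι := denseRange_toLpCLM (by norm_num)
  have norm_le (φ : 𝓢(V, ℝ)) : ‖Λ φ‖ ≤ M * ‖ι φ‖ := by
    have := ENNReal.toReal_mono
      (ENNReal.mul_ne_top ENNReal.ofReal_ne_top (φ.memLp 2 volume).2.ne) (hΛ φ)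
    rwa [toReal_enorm, ENNReal.toReal_mul, ENNReal.toReal_ofReal hM, ← norm_toLp] at this
  let G : Lp ℝ 2 (volume : Measure V) := (InnerProductSpace.toDual ℝ _).symm (Λ.extendOfNorm ι)
  have norm_G : ‖G‖ ≤ M := by
    rw [LinearIsometryEquiv.norm_map]
    exact LinearMap.opNorm_extendOfNorm_le denseRange_ι hM norm_le
  refine ⟨G, Lp.memLp G, ?_, fun φ => ?_⟩
  · rwa [ENNReal.le_ofReal_iff_toReal_le (Lp.memLp G).2.ne hM, ← Lp.norm_def]
  · rw [← LinearMap.extendOfNorm_eq denseRange_ι ⟨M, norm_le⟩ φ,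
      ← InnerProductSpace.toDual_symm_apply, L2.inner_def]
    refine integral_congr_ae ?_
    filter_upwards [φ.coeFn_toLp 2 volume] with x hx
    simp only [ι, ContinuousLinearMap.coe_coe, toLpCLM_apply, hx, G]
    simp [mul_comm]

theorem exists_memLp_integral_mul_lineDerivOp_eq {f : V → ℝ} (hf : MemLp f 2) (v : V) {M : ℝ}
    (hM : 0 ≤ M) (h : ∀ φ : 𝓢(V, ℝ), ‖∫ x, f x * ∂_{v} φ x‖ₑ ≤
      ENNReal.ofReal M * eLpNorm φ 2 volume) :
    ∃ G : V → ℝ, MemLp G 2 ∧ eLpNorm G 2 volume ≤ ENNReal.ofReal M ∧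
      ∀ φ : 𝓢(V, ℝ), ∫ x, f x * ∂_{v} φ x = -∫ x, G x * φ x := by
  have integrable_mul (φ : 𝓢(V, ℝ)) : Integrable fun x => f x * φ x :=
    hf.integrable_mul (φ.memLp 2 volume)
  let Λ : 𝓢(V, ℝ) →ₗ[ℝ] ℝ :=
    { toFun := fun φ => -∫ x, f x * ∂_{v} φ x
      map_add' := fun φ ψ => by
        rw [← neg_add, ← integral_add (integrable_mul _) (integrable_mul _)]
        simp only [LineDeriv.lineDerivOp_add, add_apply, mul_add]
      map_smul' := fun a φ => by
        rw [RingHom.id_apply, smul_neg, ← integral_smul]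
        simp only [LineDeriv.lineDerivOp_smul, smul_apply, smul_eq_mul, mul_left_comm] }
  obtain ⟨G, hG, hGM, hΛ⟩ := exists_memLp_integral_mul_eq Λ hM fun φ => by
    simpa only [Λ, LinearMap.coe_mk, AddHom.coe_mk, enorm_neg] using h φ
  exact ⟨G, hG, hGM, fun φ => by rw [← hΛ φ]; exact (neg_neg _).symm⟩

end

variable {n : ℕ} {Ω : Set (E n)} {j : Fin n} {f g g' : E n → ℝ}

theorem isWeakPartial_of_forall_schwartzMap (hg : MemLp g 2)
    (h : ∀ φ : 𝓢(E n, ℝ), ∫ x, f x * ∂_{(e j : E n)} φ x = -∫ x, g x * φ x) :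
    IsWeakPartial Ω j f g := by
  refine ⟨hg.restrict Ω, fun φ hφ hφc hφΩ => ?_⟩
  have fderiv_eq_zero (x : E n) (hx : x ∉ Ω) : fderiv ℝ φ x = 0 :=
    image_eq_zero_of_notMem_tsupport fun hx' => hx (hφΩ (tsupport_fderiv_subset ℝ hx'))
  rw [setIntegral_eq_integral_of_forall_compl_eq_zero fun x hx => by simp [fderiv_eq_zero x hx],
    setIntegral_eq_integral_of_forall_compl_eq_zero fun x hx => by
      rw [image_eq_zero_of_notMem_tsupport fun hx' => hx (hφΩ hx'), mul_zero]]
  have integral_eq := h (hφc.toSchwartzMap hφ)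
  simp only [lineDerivOp_apply_eq_fderiv] at integral_eq
  exact integral_eq

theorem IsWeakPartial.ae_eq (hΩ : IsOpen Ω) (hΩv : volume Ω ≠ ⊤) (hg : IsWeakPartial Ω j f g)
    (hg' : IsWeakPartial Ω j f g') : g =ᵐ[volume.restrict Ω] g' := by
  have : IsFiniteMeasure (volume.restrict Ω) := isFiniteMeasure_restrict.2 hΩv
  have integrableOn_sub : IntegrableOn (fun x => g x - g' x) Ω :=
    (hg.1.integrable one_le_two).sub (hg'.1.integrable one_le_two)
  have ae_zero : ∀ᵐ x, x ∈ Ω → g x - g' x = 0 := by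
    refine hΩ.ae_eq_zero_of_integral_contDiff_smul_eq_zero integrableOn_sub.locallyIntegrableOn
      fun φ hφ hφc hφΩ => ?_
    have hφ2 : MemLp φ 2 (volume.restrict Ω) :=
      (hφ.continuous.memLp_of_hasCompactSupport hφc).restrict Ω
    have integral_eq : ∫ x in Ω, g x * φ x = ∫ x in Ω, g' x * φ x :=
      neg_injective ((hg.2 φ hφ hφc hφΩ).symm.trans (hg'.2 φ hφ hφc hφΩ))
    rw [← setIntegral_eq_integral_of_forall_compl_eq_zero (s := Ω) fun x hx => by
      rw [image_eq_zero_of_notMem_tsupport fun hx' => hx (hφΩ hx'), zero_smul]]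
    simp only [smul_eq_mul, mul_comm (φ _), sub_mul]
    rw [integral_sub (by exact hg.1.integrable_mul hφ2) (by exact hg'.1.integrable_mul hφ2),
      integral_eq, sub_self]
  rw [Filter.EventuallyEq, ae_restrict_iff' hΩ.measurableSet]
  filter_upwards [ae_zero] with x hx hxΩ using sub_eq_zero.1 (hx hxΩ)

theorem IsWeakPartial.weakPartial_ae_eq (hΩ : IsOpen Ω) (hΩv : volume Ω ≠ ⊤)
    (hg : IsWeakPartial Ω j f g) : weakPartial Ω j f =ᵐ[volume.restrict Ω] g := by
  have hex : ∃ g, IsWeakPartial Ω j f g := ⟨g, hg⟩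
  rw [weakPartial, dif_pos hex]
  exact hex.choose_spec.ae_eq hΩ hΩv hg

theorem IsWeakPartial.integral_weakPartial_sq_le (hΩ : IsOpen Ω) (hΩv : volume Ω ≠ ⊤)
    (hg : IsWeakPartial Ω j f g) {M : ℝ} (hM : 0 ≤ M)
    (hgM : eLpNorm g 2 volume ≤ ENNReal.ofReal M) :
    ∫ x in Ω, weakPartial Ω j f x ^ 2 ≤ M ^ 2 := by
  rw [integral_congr_ae (g := fun x => g x ^ 2)
    ((hg.weakPartial_ae_eq hΩ hΩv).mono fun x hx => congrArg (· ^ 2) hx),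
    integral_sq_eq_toReal_eLpNorm_sq hg.1.1]
  gcongr
  exact ENNReal.toReal_le_of_le_ofReal hM ((eLpNorm_restrict_le _ _ _ _).trans hgM)

end WeakDerivative

section Forms

open scoped ENNReal

variable {n k ℓ : ℕ} {α : Type*} [MeasurableSpace α] {μ : Measure α}

theorem apply_eq_zero_or_coeff (J : Fin ℓ → Fin n) :
    (∀ w : Form n ℓ, w (fun a => e (J a)) = 0) ∨
      ∃ (I : Fin ℓ ↪o Fin n) (s : ℤˣ), ∀ w : Form n ℓ, w (fun a => e (J a)) = s • coeff I w := by
  by_cases hJ : Function.Injective J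
  · right
    let σ := Tuple.sort J
    have strictMono_sort : StrictMono (J ∘ σ) :=
      (Tuple.monotone_sort J).strictMono_of_injective (hJ.comp σ.injective)
    refine ⟨OrderEmbedding.ofStrictMono _ strictMono_sort, Equiv.Perm.sign σ, fun w => ?_⟩
    rw [show coeff (OrderEmbedding.ofStrictMono _ strictMono_sort) w =
      Equiv.Perm.sign σ • w (fun a => e (J a)) from
        w.toAlternatingMap.map_perm (fun a => e (J a)) σ, smul_smul, Int.units_mul_self, one_smul]
  · left
    exact fun w => w.map_eq_zero_of_not_injective _ fun h => hJ fun a b hab => h (congrArg e hab)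

/-- The map sending a form to the family of its coefficients. -/
def coeffMap (n ℓ : ℕ) : Form n ℓ →ₗ[ℝ] ((Fin ℓ ↪o Fin n) → ℝ) where
  toFun w I := coeff I w
  map_add' _ _ := rfl
  map_smul' _ _ := rfl

theorem coeffMap_injective (n ℓ : ℕ) : Function.Injective (coeffMap n ℓ) := by
  refine (injective_iff_map_eq_zero _).2 fun w hw =>
    ContinuousAlternatingMap.toAlternatingMap_injective
      ((EuclideanSpace.basisFun (Fin n) ℝ).toBasis.ext_alternating fun J _ => ?_)
  simp only [OrthonormalBasis.coe_toBasis, EuclideanSpace.basisFun_apply]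
  rcases apply_eq_zero_or_coeff J with h | ⟨I, s, h⟩
  · exact h w
  · exact (h w).trans (by rw [show coeff I w = 0 from congrFun hw I, smul_zero]; rfl)

instance (n ℓ : ℕ) : FiniteDimensional ℝ (Form n ℓ) :=
  Module.Finite.of_injective (coeffMap n ℓ) (coeffMap_injective n ℓ)

theorem integrable_of_coeff {f : α → Form n ℓ} (h : ∀ I, Integrable (fun x => coeff I (f x)) μ) :
    Integrable f μ := by
  obtain ⟨L, hL⟩ := (coeffMap n ℓ).exists_leftInverse_of_injective
    (LinearMap.ker_eq_bot.2 (coeffMap_injective n ℓ))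
  have integrable_coeffMap : Integrable (fun x => coeffMap n ℓ (f x)) μ := Integrable.of_eval h
  exact (L.toContinuousLinearMap.integrable_comp integrable_coeffMap).congr
    (.of_forall fun x => LinearMap.congr_fun hL (f x))

theorem coeff_integral {f : α → Form n ℓ} (h : Integrable f μ) (I : Fin ℓ ↪o Fin n) :
    coeff I (∫ x, f x ∂μ) = ∫ x, coeff I (f x) ∂μ :=
  ((LinearMap.proj I ∘ₗ coeffMap n ℓ).toContinuousLinearMap.integral_comp_comm h).symm

theorem coeff_curryLeft (I : Fin k ↪o Fin n) (w : Form n (k + 1)) (z : E n) :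
    coeff I (w.curryLeft z) = ∑ i, z i * w (fun a => e (Matrix.vecCons i I a)) := by
  have sum_coord_smul : ∑ i, z i • (e i : E n) = z := by
    simpa [e] using (EuclideanSpace.basisFun (Fin n) ℝ).sum_repr z
  have coeff_e (i : Fin n) :
      coeff I (w.curryLeft (e i)) = w (fun a => e (Matrix.vecCons i I a)) := by
    rw [coeff, ContinuousAlternatingMap.curryLeft_apply_apply]
    congr 1
    funext a
    cases a using Fin.cases <;> simp
  have := congrArg (LinearMap.proj I ∘ₗ coeffMap n k ∘ₗ w.curryLeft.toLinearMap) sum_coord_smul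
  rw [map_sum] at this
  simp only [map_smul, smul_eq_mul] at this
  simp only [← coeff_e]
  exact this.symm

variable {Ω : Set (E n)} {u : E n → Form n ℓ}

theorem MemL2.eLpNorm_coeff_le (hu : MemL2 Ω u) (I : Fin ℓ ↪o Fin n) :
    eLpNorm (fun x => coeff I (u x)) 2 (volume.restrict Ω) ≤ ENNReal.ofReal (l2Norm Ω u) := by
  rw [← ENNReal.ofReal_toReal (hu I).2.ne]
  refine ENNReal.ofReal_le_ofReal (Real.le_sqrt_of_sq_le ?_)
  rw [← integral_sq_eq_toReal_eLpNorm_sq (hu I).1]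
  exact Finset.single_le_sum (f := fun I => ∫ x in Ω, coeff I (u x) ^ 2)
    (fun I _ => integral_nonneg fun x => sq_nonneg _) (Finset.mem_univ I)

theorem MemL2.memLp_apply (hu : MemL2 Ω u) (J : Fin ℓ → Fin n) :
    MemLp (fun x => u x (fun a => e (J a))) 2 (volume.restrict Ω) := by
  rcases apply_eq_zero_or_coeff J with h | ⟨I, s, h⟩ <;> simp only [h]
  · exact MemLp.zero'
  · rcases Int.units_eq_one_or s with rfl | rfl
    · simpa using hu I
    · simpa [Pi.neg_def] using (hu I).neg

theorem MemL2.eLpNorm_apply_le (hu : MemL2 Ω u) (J : Fin ℓ → Fin n) :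
    eLpNorm (fun x => u x (fun a => e (J a))) 2 (volume.restrict Ω) ≤
      ENNReal.ofReal (l2Norm Ω u) := by
  rcases apply_eq_zero_or_coeff J with h | ⟨I, s, h⟩ <;> simp only [h]
  · simp
  · refine le_trans (eLpNorm_mono_ae (.of_forall fun x => ?_)) (hu.eLpNorm_coeff_le I)
    rcases Int.units_eq_one_or s with rfl | rfl <;> simp

end Forms

section Components

open scoped ENNReal LineDeriv
open SchwartzMap

variable {n k : ℕ} {Ω : Set (E n)} {u : E n → Form n (k + 1)} {θ : E n → ℝ}

/-- The component `u_{(i, I)} = u(e_i, e_{I 0}, …, e_{I (k-1)})`, extended by zero outside `Ω`. -/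
def component (Ω : Set (E n)) (u : E n → Form n (k + 1)) (I : Fin k ↪o Fin n) (i : Fin n) :
    E n → ℝ :=
  Ω.indicator fun y => u y (fun a => e (Matrix.vecCons i I a))

theorem MemL2.memLp_component (hΩ : MeasurableSet Ω) (hu : MemL2 Ω u) (I : Fin k ↪o Fin n)
    (i : Fin n) : MemLp (component Ω u I i) 2 :=
  (memLp_indicator_iff_restrict hΩ).2 (hu.memLp_apply _)

theorem MemL2.eLpNorm_component_le (hΩ : MeasurableSet Ω) (hu : MemL2 Ω u) (I : Fin k ↪o Fin n)
    (i : Fin n) : eLpNorm (component Ω u I i) 2 volume ≤ ENNReal.ofReal (l2Norm Ω u) := by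
  rw [component, eLpNorm_indicator_eq_eLpNorm_restrict hΩ]
  exact hu.eLpNorm_apply_le _

theorem isBounded_support_component (hb : Bornology.IsBounded Ω) (I : Fin k ↪o Fin n)
    (i : Fin n) : Bornology.IsBounded (Function.support (component Ω u I i)) :=
  hb.subset support_indicator_subset

theorem indicator_coeff_bogIntegrand (I : Fin k ↪o Fin n) (x : E n) :
    Ω.indicator (fun y => coeff I (bogIntegrand θ u x y)) =
      fun y => ∑ i, kernelG (k + 1) θ x y * (x - y) i * component Ω u I i y := by
  funext y
  have coeff_bogIntegrand : coeff I (bogIntegrand θ u x y) =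
      kernelG (k + 1) θ x y * coeff I ((u y).curryLeft (x - y)) := rfl
  by_cases hy : y ∈ Ω
  · simp only [indicator_of_mem hy, coeff_bogIntegrand, coeff_curryLeft, component,
      Finset.mul_sum, mul_assoc]
  · simp [component, hy]

theorem integrableOn_bogIntegrand {x : E n} (hΩ : MeasurableSet Ω)
    (hx : ∀ (I : Fin k ↪o Fin n) (i : Fin n),
      Integrable fun y => kernelG (k + 1) θ x y * (x - y) i * component Ω u I i y) :
    IntegrableOn (bogIntegrand θ u x) Ω := by
  refine integrable_of_coeff fun I => ?_
  rw [← IntegrableOn, ← integrable_indicator_iff hΩ, indicator_coeff_bogIntegrand]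
  exact integrable_finsetSum _ fun i _ => hx I i

theorem coeff_bogovskii {x : E n} (hΩ : MeasurableSet Ω)
    (hx : ∀ (I : Fin k ↪o Fin n) (i : Fin n),
      Integrable fun y => kernelG (k + 1) θ x y * (x - y) i * component Ω u I i y)
    (I : Fin k ↪o Fin n) :
    coeff I (bogovskii θ Ω u x) = ∑ i, bogScalar k θ i (component Ω u I i) x := by
  rw [bogovskii, coeff_integral (integrableOn_bogIntegrand hΩ hx), ← integral_indicator hΩ,
    indicator_coeff_bogIntegrand, integral_finsetSum _ fun i _ => hx I i]
  rfl

section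

variable (hk : k + 1 ≤ n) (hθ : Continuous θ) (hθc : HasCompactSupport θ) (hΩ : MeasurableSet Ω)
  (hb : Bornology.IsBounded Ω) (hu : MemL2 Ω u)
include hk hθ hθc hΩ hb hu

theorem MemL2.ae_integrable_kernelG_mul_component :
    ∀ᵐ x, ∀ (I : Fin k ↪o Fin n) (i : Fin n),
      Integrable fun y => kernelG (k + 1) θ x y * (x - y) i * component Ω u I i y :=
  ae_all_iff.2 fun I => ae_all_iff.2 fun i => ae_integrable_kernelG_mul hk hθ hθc
    (hu.memLp_component hΩ I i) (isBounded_support_component hb I i) i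

theorem MemL2.coeff_bogovskii_ae_eq (I : Fin k ↪o Fin n) :
    (fun x => coeff I (bogovskii θ Ω u x)) =ᵐ[volume]
      fun x => ∑ i, bogScalar k θ i (component Ω u I i) x := by
  filter_upwards [hu.ae_integrable_kernelG_mul_component hk hθ hθc hΩ hb] with x hx
    using coeff_bogovskii hΩ hx I

theorem MemL2.memLp_bogScalar_component (I : Fin k ↪o Fin n) (i : Fin n) :
    MemLp (bogScalar k θ i (component Ω u I i)) 2 :=
  memLp_bogScalar hk hθ hθc (hu.memLp_component hΩ I i) (isBounded_support_component hb I i) i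

theorem MemL2.memLp_coeff_bogovskii (I : Fin k ↪o Fin n) :
    MemLp (fun x => coeff I (bogovskii θ Ω u x)) 2 :=
  (memLp_finsetSum _ fun i _ => hu.memLp_bogScalar_component hk hθ hθc hΩ hb I i).ae_eq
    (hu.coeff_bogovskii_ae_eq hk hθ hθc hΩ hb I).symm

end

end Components

section GradientBound

open scoped ENNReal LineDeriv
open SchwartzMap

variable {n k : ℕ} {Ω : Set (E n)} {u : E n → Form n (k + 1)} {c : E n} {r A : ℝ}
  {θ : 𝓢(E n, ℝ)}

theorem h1Seminorm_le {v : E n → Form n k} {M : ℝ} (hM : 0 ≤ M)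
    (h : ∀ (I : Fin k ↪o Fin n) (j : Fin n),
      ∫ x in Ω, weakPartial Ω j (fun z => coeff I (v z)) x ^ 2 ≤ M ^ 2) :
    h1Seminorm Ω v ≤ √(Fintype.card (Fin k ↪o Fin n) * n) * M := by
  rw [← Real.sqrt_sq hM, ← Real.sqrt_mul (by positivity)]
  refine Real.sqrt_le_sqrt ((Finset.sum_le_sum fun I _ => Finset.sum_le_sum fun j _ =>
    h I j).trans_eq ?_)
  simp [mul_assoc]

/-- The constant in the bound for one partial derivative of one coefficient of `B_ℓ u`,
`ℓ = k + 1`; the factor `n` counts the components `u_{(i, I)}` entering the coefficient. -/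
def gradConst (n k : ℕ) : ℝ := n * (4 * (n + 1) * pairingConst n k (ballConst n))

theorem gradConst_pos (hk : k + 1 ≤ n) : 0 < gradConst n k :=
  mul_pos (by exact_mod_cast Nat.zero_lt_of_lt hk)
    (mul_pos (by positivity) (pairingConst_pos _ _ _))

theorem enorm_integral_bogScalar_component_mul_lineDerivOp_le (hk : k + 1 ≤ n)
    (hΩ : MeasurableSet Ω) (hb : Bornology.IsBounded Ω) (hr : 0 < r)
    (hball : Metric.ball c r ⊆ Ω) (hsupp : tsupport θ ⊆ Metric.closedBall c r)
    (hθ : HasScaledBounds A (Metric.diam (Metric.ball c r)) θ) (hu : MemL2 Ω u)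
    (I : Fin k ↪o Fin n) (i j : Fin n) (φ : 𝓢(E n, ℝ)) :
    ‖∫ x, bogScalar k θ i (component Ω u I i) x * ∂_{(e j : E n)} φ x‖ₑ ≤
      ENNReal.ofReal (4 * (n + 1) * pairingConst n k (ballConst n) * A *
        (Metric.diam Ω / Metric.diam (Metric.ball c r)) *
        kappa n (k + 1) (volume.real Ω / volume.real (Metric.ball c r))) *
      (ENNReal.ofReal (l2Norm Ω u) * eLpNorm φ 2 volume) := by
  have : Nonempty (Fin n) := ⟨i⟩
  have diam_ball : Metric.diam (Metric.ball c r) = 2 * r := Metric.diam_ball_eq c hr.le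
  have diam_le : Metric.diam (Metric.ball c r) ≤ Metric.diam Ω := Metric.diam_mono hball hb
  have norm_sub_le (y : E n) (hy : y ∈ Function.support (component Ω u I i)) :
      ‖y - c‖ ≤ Metric.diam Ω := by
    rw [← dist_eq_norm]
    exact Metric.dist_le_diam_of_mem hb (support_indicator_subset hy)
      (hball (Metric.mem_ball_self hr))
  rw [diam_ball] at hθ diam_le ⊢
  refine (enorm_integral_bogScalar_mul_lineDerivOp_le hk (by positivity) diam_le (le_max_left _ _)
    (one_le_volume_ratio hr hball hb.measure_lt_top.ne) hθ
    (hsupp.trans (Metric.closedBall_subset_closedBall (by linarith))) hΩ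
    (volume_le_ballConst_mul c hr hb.measure_lt_top.ne) (hu.memLp_component hΩ I i) norm_sub_le
    (fun y hy => indicator_of_notMem hy _) φ i j).trans ?_
  exact mul_le_mul_right (mul_le_mul_left (hu.eLpNorm_component_le hΩ I i) _) _

/-- The bound `C A (R / ρ) κ ‖u‖` for one partial derivative of one coefficient of `B_ℓ u`, where
`R` and `ρ` are the diameters of `Ω` and of the ball of centre `c` and radius `r`. -/
def gradBound (A : ℝ) (c : E n) (r : ℝ) (Ω : Set (E n)) (u : E n → Form n (k + 1)) : ℝ :=
  gradConst n k * A * (Metric.diam Ω / Metric.diam (Metric.ball c r)) *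
    kappa n (k + 1) (volume.real Ω / volume.real (Metric.ball c r)) * l2Norm Ω u

theorem gradBound_nonneg (hk : k + 1 ≤ n) (hA : 0 ≤ A) (hb : Bornology.IsBounded Ω) (hr : 0 < r)
    (hball : Metric.ball c r ⊆ Ω) : 0 ≤ gradBound A c r Ω u := by
  have := gradConst_pos hk
  have := one_le_kappa n (k + 1) (one_le_volume_ratio hr hball hb.measure_lt_top.ne)
  have : 0 ≤ l2Norm Ω u := Real.sqrt_nonneg _
  unfold gradBound
  positivity

section

variable (hk : k + 1 ≤ n) (hb : Bornology.IsBounded Ω) (hr : 0 < r)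
  (hball : Metric.ball c r ⊆ Ω) (hsupp : tsupport θ ⊆ Metric.closedBall c r)
  (hθ : HasScaledBounds A (Metric.diam (Metric.ball c r)) θ) (hu : MemL2 Ω u)
include hk hb hr hball hsupp hθ hu

theorem enorm_integral_coeff_bogovskii_mul_lineDerivOp_le (hΩ : MeasurableSet Ω)
    (I : Fin k ↪o Fin n) (j : Fin n) (φ : 𝓢(E n, ℝ)) :
    ‖∫ x, coeff I (bogovskii θ Ω u x) * ∂_{(e j : E n)} φ x‖ₑ ≤
      ENNReal.ofReal (gradBound A c r Ω u) * eLpNorm φ 2 volume := by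
  have hθc : HasCompactSupport θ := hasCompactSupport_of_tsupport_subset_closedBall hsupp
  have hA := hθ.nonneg
  have hκ := one_le_kappa n (k + 1) (one_le_volume_ratio hr hball hb.measure_lt_top.ne)
  have hP := pairingConst_pos n k (ballConst n)
  have integral_eq : ∫ x, coeff I (bogovskii θ Ω u x) * ∂_{(e j : E n)} φ x =
      ∑ i, ∫ x, bogScalar k θ i (component Ω u I i) x * ∂_{(e j : E n)} φ x := by
    rw [← integral_finsetSum (f := fun i x => bogScalar k θ i (component Ω u I i) x *
      ∂_{(e j : E n)} φ x) _ fun i _ =>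
        (hu.memLp_bogScalar_component hk θ.continuous hθc hΩ hb I i).integrable_mul
          ((∂_{(e j : E n)} φ : 𝓢(E n, ℝ)).memLp 2 volume)]
    refine integral_congr_ae ?_
    filter_upwards [hu.coeff_bogovskii_ae_eq hk θ.continuous hθc hΩ hb I] with x hx
    rw [hx, Finset.sum_mul]
  rw [integral_eq]
  refine (enorm_sum_le _ _).trans ((Finset.sum_le_sum fun i _ =>
    enorm_integral_bogScalar_component_mul_lineDerivOp_le hk hΩ hb hr hball hsupp hθ hu I i j
      φ).trans_eq ?_)
  rw [Finset.sum_const, Finset.card_univ, Fintype.card_fin, nsmul_eq_mul, ← mul_assoc, ← mul_assoc,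
    mul_assoc (n : ℝ≥0∞), ← ENNReal.ofReal_mul (by positivity), ← ENNReal.ofReal_natCast,
    ← ENNReal.ofReal_mul (by positivity), gradBound, gradConst]
  congr 2
  ring

theorem exists_isWeakPartial_coeff_bogovskii (hΩ : MeasurableSet Ω) (I : Fin k ↪o Fin n)
    (j : Fin n) : ∃ g, IsWeakPartial Ω j (fun x => coeff I (bogovskii θ Ω u x)) g ∧
      eLpNorm g 2 volume ≤ ENNReal.ofReal (gradBound A c r Ω u) := by
  have hθc : HasCompactSupport θ := hasCompactSupport_of_tsupport_subset_closedBall hsupp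
  obtain ⟨g, hg, hgM, integral_eq⟩ := exists_memLp_integral_mul_lineDerivOp_eq
    (hu.memLp_coeff_bogovskii hk θ.continuous hθc hΩ hb I) (e j)
    (gradBound_nonneg hk hθ.nonneg hb hr hball)
    (enorm_integral_coeff_bogovskii_mul_lineDerivOp_le hk hb hr hball hsupp hθ hu hΩ I j)
  exact ⟨g, isWeakPartial_of_forall_schwartzMap hg integral_eq, hgM⟩

theorem formMemH1_bogovskii (hΩ : MeasurableSet Ω) : FormMemH1 Ω (bogovskii θ Ω u) := by
  have hθc : HasCompactSupport θ := hasCompactSupport_of_tsupport_subset_closedBall hsupp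
  exact fun I => ⟨(hu.memLp_coeff_bogovskii hk θ.continuous hθc hΩ hb I).restrict Ω, fun j =>
    (exists_isWeakPartial_coeff_bogovskii hk hb hr hball hsupp hθ hu hΩ I j).imp fun _ h => h.1⟩

theorem h1Seminorm_bogovskii_le (hΩ : IsOpen Ω) :
    h1Seminorm Ω (bogovskii θ Ω u) ≤
      √(Fintype.card (Fin k ↪o Fin n) * n) * gradBound A c r Ω u := by
  have hM := gradBound_nonneg (u := u) hk hθ.nonneg hb hr hball
  refine h1Seminorm_le hM fun I j => ?_
  obtain ⟨g, hg, hgM⟩ := exists_isWeakPartial_coeff_bogovskii hk hb hr hball hsupp hθ hu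
    hΩ.measurableSet I j
  exact hg.integral_weakPartial_sq_le hΩ hb.measure_lt_top.ne hM hgM

end

end GradientBound

end BogForms

end

open BogForms SchwartzMap in
theorem mainTheorem2_general (n k : ℕ) (hk : k + 1 ≤ n) :
    ∃ C : ℝ, 0 < C ∧ ∀ (A : ℝ) (Ω : Set (E n)) (c : E n) (r : ℝ) (θ : 𝓢(E n, ℝ)),
      IsOpen Ω → Bornology.IsBounded Ω → 0 < r → Metric.ball c r ⊆ Ω →
      tsupport θ ⊆ Metric.closedBall c r →
      HasScaledBounds A (Metric.diam (Metric.ball c r)) θ →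
      ∀ u : E n → Form n (k + 1), MemL2 Ω u →
        (∀ᵐ x, IntegrableOn (bogIntegrand θ u x) Ω) ∧
        FormMemH1 Ω (bogovskii θ Ω u) ∧
        h1Seminorm Ω (bogovskii θ Ω u) ≤
          C * A * (Metric.diam Ω / Metric.diam (Metric.ball c r)) *
            kappa n (k + 1) (volume.real Ω / volume.real (Metric.ball c r)) * l2Norm Ω u := by
  have : Nonempty (Fin k ↪o Fin n) := ⟨Fin.castLEOrderEmb (by omega)⟩
  refine ⟨√(Fintype.card (Fin k ↪o Fin n) * n) * gradConst n k,
    mul_pos (Real.sqrt_pos.2 (mul_pos (by exact_mod_cast Fintype.card_pos)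
      (by exact_mod_cast Nat.zero_lt_of_lt hk))) (gradConst_pos hk),
    fun A Ω c r θ hΩ hb hr hball hsupp hθ u hu => ⟨?_, ?_, ?_⟩⟩
  · have hθc : HasCompactSupport θ := hasCompactSupport_of_tsupport_subset_closedBall hsupp
    filter_upwards [hu.ae_integrable_kernelG_mul_component hk θ.continuous hθc hΩ.measurableSet hb]
      with x hx using integrableOn_bogIntegrand hΩ.measurableSet hx
  · exact formMemH1_bogovskii hk hb hr hball hsupp hθ hu hΩ.measurableSet
  · refine (h1Seminorm_bogovskii_le hk hb hr hball hsupp hθ hu hΩ).trans_eq ?_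
    rw [gradBound]
    ring

/-- The degree `ℓ ∈ {1, …, n}` is written `ℓ = k + 1`. The constant `C` depends only on `n`, `ℓ`
and on the constants `K` in the bounds that the weight `θ` is required to satisfy. -/
theorem mainTheorem2 (n k : ℕ) (hk : k + 1 ≤ n) (K : (i : ℕ) → (Fin i → Fin n) → ℝ) :
    ∃ C : ℝ, 0 < C ∧
      ∀ (Ω : Set (BogForms.E n)) (c : BogForms.E n) (r : ℝ) (θ : BogForms.E n → ℝ),
        IsOpen Ω → Bornology.IsBounded Ω → 0 < r →
        BogForms.StarShapedWrt Ω (Metric.ball c r) →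
        BogForms.IsWeight K c r θ →
        ∀ u : BogForms.E n → BogForms.Form n (k + 1), BogForms.MemL2 Ω u →
          (∀ᵐ x ∂(MeasureTheory.volume.restrict Ω),
            MeasureTheory.IntegrableOn (BogForms.bogIntegrand θ u x) Ω) ∧
          BogForms.FormMemH1 Ω (BogForms.bogovskii θ Ω u) ∧
          BogForms.h1Seminorm Ω (BogForms.bogovskii θ Ω u) ≤
            C * (Metric.diam Ω / Metric.diam (Metric.ball c r)) *
              BogForms.kappa n (k + 1)
                (MeasureTheory.volume.real Ω / MeasureTheory.volume.real (Metric.ball c r)) *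
              BogForms.l2Norm Ω u := by
  obtain ⟨C, hC, bogovskii_bound⟩ := mainTheorem2_general n k hk
  refine ⟨C * BogForms.weightConst K, mul_pos hC (BogForms.weightConst_pos K),
    fun Ω c r θ hΩ hb hr hstar hθ u hu => ?_⟩
  let θ' : SchwartzMap (BogForms.E n) ℝ :=
    (BogForms.hasCompactSupport_of_tsupport_subset_closedBall hθ.supp).toSchwartzMap hθ.smooth
  have hθ' : BogForms.IsWeight K c r θ' := hθ
  exact (bogovskii_bound _ Ω c r θ' hΩ hb hr hstar.1 hθ.supp hθ'.hasScaledBounds u hu).imp_left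
    ae_restrict_of_ae
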